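/- A *Nehari function* is a positive, even, continuous function $p$ on $(-1,1)$ such that $(1-x^2)^2p(x)$ is non-increasing on $[0,1)$ and no nontrivial solution of $u''+pu=0$ on $(-1,1)$ has more than one zero in $(-1,1)$. Let $p$ be a Nehari function, let $\mathbb{D}$ be the open unit disk, and let $\phi=(f_1,\dots,f_n):\mathbb{D}\to\mathbb{C}^n$ be holomorphic with $\phi'(z)\neq 0$ for all $z\in\mathbb{D}$. Put $\sigma=\frac12\log\left(|f_1'|^2+\cdots+|f_n'|^2\right)$ and $\mathcal{S}\phi=2(\sigma_{zz}-\sigma_z^2)$, where $\partial_z=\frac12(\partial_x-i\partial_y)$, and let $K(\phi(z))$ be the Gaussian curvature at $\phi(z)$ of the immersed surface $\phi(\mathbb{D})\subset\mathbb{C}^n=\mathbb{R}^{2n}$, that is, the curvature at $z$ of the metric induced by $\phi$ on $\mathbb{D}$. If $$|\mathcal{S}\phi(z)|+\tfrac34\,|\phi'(z)|^2\,|K(\phi(z))|\le 2p(|z|)\qquad\text{for all } z\in\mathbb{D},$$ then $\phi$ is injective on $\mathbb{D}$. For $n=1$ and $\phi=f$ one has $K=0$, and $\mathcal{S}\phi$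 is the classical Schwarzian $\mathcal{S}f=(f''/f')'-\frac12(f''/f')^2$; so the theorem contains Nehari's criterion: if $f:\mathbb{D}\to\mathbb{C}$ is holomorphic with $f'\neq0$ and $|\mathcal{S}f(z)|\le 2p(|z|)$ on $\mathbb{D}$, then $f$ is injective. -/

import Mathlib

open Complex Set

namespace HolCurve

noncomputable section

/-- A Nehari function: positive, even and continuous on `(-1, 1)`, such that `(1 - x²)² p(x)` is
non-increasing on `[0, 1)`, and such that a solution of `u'' + p u = 0` on `(-1, 1)` with two
distinct zeros in `(-1, 1)` is identically zero there (`v` stands for `u'`). -/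
structure IsNehari (p : ℝ → ℝ) : Prop where
  pos : ∀ x ∈ Ioo (-1 : ℝ) 1, 0 < p x
  even : ∀ x ∈ Ioo (-1 : ℝ) 1, p (-x) = p x
  continuousOn : ContinuousOn p (Ioo (-1 : ℝ) 1)
  antitoneOn : AntitoneOn (fun x : ℝ => (1 - x ^ 2) ^ 2 * p x) (Ico (0 : ℝ) 1)
  disconjugate : ∀ u v : ℝ → ℝ,
    (∀ x ∈ Ioo (-1 : ℝ) 1, HasDerivAt u (v x) x) →
    (∀ x ∈ Ioo (-1 : ℝ) 1, HasDerivAt v (-(p x * u x)) x) →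
    ∀ a ∈ Ioo (-1 : ℝ) 1, ∀ b ∈ Ioo (-1 : ℝ) 1, a ≠ b → u a = 0 → u b = 0 →
      ∀ x ∈ Ioo (-1 : ℝ) 1, u x = 0

/-- The partial derivative `∂g/∂x` of a function of `z = x + i y`. -/
def dx {F : Type*} [NormedAddCommGroup F] [NormedSpace ℝ F] (g : ℂ → F) (z : ℂ) : F :=
  fderiv ℝ g z 1

/-- The partial derivative `∂g/∂y` of a function of `z = x + i y`. -/
def dy {F : Type*} [NormedAddCommGroup F] [NormedSpace ℝ F] (g : ℂ → F) (z : ℂ) : F :=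
  fderiv ℝ g z I

/-- The Wirtinger derivative `g_z = (g_x - i g_y) / 2`. -/
def dz (g : ℂ → ℂ) (z : ℂ) : ℂ :=
  (dx g z - I * dy g z) / 2

/-- `σ = (1/2) log (|f₁'|² + ⋯ + |fₙ'|²)` for the curve `φ = (f₁, …, fₙ)`. -/
def logFactor {n : ℕ} (φ : ℂ → EuclideanSpace ℂ (Fin n)) (z : ℂ) : ℝ :=
  1 / 2 * Real.log (∑ k, ‖deriv (fun w => φ w k) z‖ ^ 2)

/-- The Schwarzian derivative `2 (σ_zz - σ_z²)` of the curve `φ`. -/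
def schwarzian {n : ℕ} (φ : ℂ → EuclideanSpace ℂ (Fin n)) (z : ℂ) : ℂ :=
  2 * (dz (dz (fun w => (logFactor φ w : ℂ))) z - dz (fun w => (logFactor φ w : ℂ)) z ^ 2)

/-- The classical Schwarzian derivative `(f''/f')' - (1/2) (f''/f')²`. -/
def classicalSchwarzian (f : ℂ → ℂ) (z : ℂ) : ℂ :=
  deriv (fun w => deriv (deriv f) w / deriv f w) z - 1 / 2 * (deriv (deriv f) z / deriv f z) ^ 2

/-- The Gaussian curvature of the Riemannian metric `E dx² + 2 F dx dy + G dy²` on a plane domain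
(Brioschi's formula). -/
def metricCurvature (E F G : ℂ → ℝ) (z : ℂ) : ℝ :=
  ((!![-(1 / 2) * dy (dy E) z + dx (dy F) z - 1 / 2 * dx (dx G) z,
        1 / 2 * dx E z, dx F z - 1 / 2 * dy E z;
      dy F z - 1 / 2 * dx G z, E z, F z;
      1 / 2 * dy G z, F z, G z]).det -
    (!![0, 1 / 2 * dy E z, 1 / 2 * dx G z;
      1 / 2 * dy E z, E z, F z;
      1 / 2 * dx G z, F z, G z]).det) / (E z * G z - F z ^ 2) ^ 2

/-- The Gaussian curvature, at the parameter value `z`, of the surface in a real inner product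
space that is parametrized by `X`: the curvature of the induced metric (the first fundamental
form of `X`). -/
def gaussianCurvature {V : Type*} [NormedAddCommGroup V] [InnerProductSpace ℝ V]
    (X : ℂ → V) (z : ℂ) : ℝ :=
  metricCurvature (fun w => inner ℝ (dx X w) (dx X w)) (fun w => inner ℝ (dx X w) (dy X w))
    (fun w => inner ℝ (dy X w) (dy X w)) z

end

end HolCurve

namespace HolCurve

open scoped NNReal
open Filter Topology

/-! The core is a statement about curves. For a regular curve `γ` in a real inner product space, put
`u = |γ - γ(a)| / √|γ'|`, and let `S` be the Ahlfors Schwarzian of `γ`. Cauchy–Schwarz gives `u'' +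
(S/2) u ≥ 0` wherever `γ ≠ γ(a)` (`neg_curveSchwarzian_le`). If `S ≤ 2p`, compare `u` with the
solution of `y'' + p y = 0`, `y(a) = 0`, `y'(a) = 1`. Disconjugacy keeps `y` positive to the right
of `a`, and `u / y` is non-decreasing up to the first return of `γ` to `γ(a)`; hence there is no
return (`sturm_comparison`, `injOn_of_curveSchwarzian_le`).

For the disk, join two points by a hyperbolic geodesic, parametrized as `T(t)`, `-1 < t < 1`, by an
automorphism `T` taking `0` to the point of the geodesic closest to the origin
(`exists_moebius_eq_eq`). Then `|t| ≤ |T(t)|` and `|T'(t)| (1 - t²) = 1 - |T(t)|²`, so the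
monotonicity of `(1 - x²)² p` yields `|T'(t)|² p(|T(t)|) ≤ p(t)` (`nehari_weight_le`). As `T` has
zero Schwarzian, the Ahlfors Schwarzian of `φ ∘ T` is `Re(T'² 𝒮φ) + (3/4) |T'|² |φ'|² |K|`
(`curveSchwarzian_eq`, `schwarzianForm_chain`, `normalForm_chain`). The hypothesis bounds this by
`2p(t)`, and the result on curves applies. -/

/-! ### Solutions of `u'' + q u = 0` on `(-1, 1)` -/

/-- The first-order system on `ℝ × ℝ` of the equation `u'' + q u = 0`. -/
def linearField (q : ℝ → ℝ) (t : ℝ) (y : ℝ × ℝ) : ℝ × ℝ := (y.2, -(q t * y.1))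

theorem lipschitzWith_linearField {q : ℝ → ℝ} {t : ℝ} {K : ℝ≥0} (hK : 1 ≤ K)
    (hq : |q t| ≤ K) : LipschitzWith K (linearField q t) := by
  refine LipschitzWith.of_dist_le_mul fun x y => ?_
  rw [Prod.dist_eq, Prod.dist_eq]
  have hK' : (1 : ℝ) ≤ K := hK
  have h1 := le_max_left (dist x.1 y.1) (dist x.2 y.2)
  have h2 := le_max_right (dist x.1 y.1) (dist x.2 y.2)
  have h0 := dist_nonneg (x := x.1) (y := y.1)
  refine max_le ?_ ?_
  · change dist x.2 y.2 ≤ _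
    nlinarith
  · have : dist (linearField q t x).2 (linearField q t y).2 = |q t| * dist x.1 y.1 := by
      rw [Real.dist_eq, Real.dist_eq, ← abs_mul, ← abs_neg]
      congr 1
      simp only [linearField]
      ring
    rw [this]
    exact mul_le_mul hq h1 h0 K.2

/-- The map that cuts both coordinates off at `±R`. -/
def clampPair (R : ℝ) (y : ℝ × ℝ) : ℝ × ℝ := (max (-R) (min R y.1), max (-R) (min R y.2))

theorem lipschitzWith_clampPair (R : ℝ) : LipschitzWith 1 (clampPair R) := by
  have h1 : LipschitzWith 1 fun y : ℝ × ℝ => max (-R) (min R y.1) :=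
    (LipschitzWith.prod_fst.const_min R).const_max (-R)
  have h2 : LipschitzWith 1 fun y : ℝ × ℝ => max (-R) (min R y.2) :=
    (LipschitzWith.prod_snd.const_min R).const_max (-R)
  simpa using! h1.prodMk h2

theorem clampPair_of_norm_le {R : ℝ} {y : ℝ × ℝ} (h : ‖y‖ ≤ R) : clampPair R y = y := by
  have h1 := abs_le.1 ((norm_fst_le y).trans h)
  have h2 := abs_le.1 ((norm_snd_le y).trans h)
  ext
  · simp [clampPair, h1.1, h1.2]
  · simp [clampPair, h2.1, h2.2]

theorem abs_clamp_le {R : ℝ} (hR : 0 ≤ R) (x : ℝ) :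
    |max (-R) (min R x)| ≤ R ∧ |max (-R) (min R x)| ≤ |x| := by
  constructor
  · exact abs_le.2 ⟨le_max_left _ _, max_le (by linarith) (min_le_left _ _)⟩
  · refine abs_le.2 ⟨?_, max_le (by linarith [abs_nonneg x]) ((min_le_right _ _).trans (le_abs_self x))⟩
    rcases le_total R x with h | h
    · rw [min_eq_left h]
      exact le_max_of_le_right (by linarith [abs_nonneg x])
    · rw [min_eq_right h]
      exact le_max_of_le_right (neg_abs_le x)

theorem norm_clampPair_le {R : ℝ} (hR : 0 ≤ R) (y : ℝ × ℝ) :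
    ‖clampPair R y‖ ≤ R ∧ ‖clampPair R y‖ ≤ ‖y‖ := by
  constructor
  · exact max_le (abs_clamp_le hR _).1 (abs_clamp_le hR _).1
  · exact max_le_max (abs_clamp_le hR _).2 (abs_clamp_le hR _).2

/-- Grönwall's inequality in both directions from `t₀`; the backward half is the forward one applied
to `s ↦ y (t₀ - s)`. -/
theorem norm_le_of_norm_deriv_le_mul {E : Type*} [NormedAddCommGroup E] [NormedSpace ℝ E]
    {y y' : ℝ → E} {c d t₀ K : ℝ} (ht₀ : t₀ ∈ Icc c d) (hK : 0 ≤ K)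
    (hy : ∀ t ∈ Icc c d, HasDerivWithinAt y (y' t) (Icc c d) t)
    (hle : ∀ t ∈ Icc c d, ‖y' t‖ ≤ K * ‖y t‖) :
    ∀ t ∈ Icc c d, ‖y t‖ ≤ ‖y t₀‖ * Real.exp (K * (d - c)) := by
  have hexp : ∀ s ≤ d - c, ‖y t₀‖ * Real.exp (K * s) ≤ ‖y t₀‖ * Real.exp (K * (d - c)) :=
    fun s hs => mul_le_mul_of_nonneg_left
      (Real.exp_le_exp.2 (mul_le_mul_of_nonneg_left hs hK)) (norm_nonneg _)
  intro t ht
  rcases le_total t₀ t with h | h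
  · have := norm_le_gronwallBound_of_norm_deriv_right_le (f := y) (f' := y') (δ := ‖y t₀‖)
      (K := K) (ε := 0) (a := t₀) (b := d)
      (fun s hs => ((hy s ⟨ht₀.1.trans hs.1, hs.2⟩).continuousWithinAt).mono
        (Icc_subset_Icc_left ht₀.1))
      (fun s hs => (hy s ⟨ht₀.1.trans hs.1, hs.2.le⟩).mono_of_mem_nhdsWithin
        (mem_of_superset (Icc_mem_nhdsGE hs.2) (Icc_subset_Icc_left (ht₀.1.trans hs.1))))
      le_rfl (fun s hs => by simpa using! hle s ⟨ht₀.1.trans hs.1, hs.2.le⟩) t ⟨h, ht.2⟩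
    rw [gronwallBound_ε0] at this
    exact this.trans (hexp _ (by linarith [ht.2, ht₀.1]))
  · have hz : ∀ s ∈ Icc 0 (t₀ - c),
        HasDerivWithinAt (fun s => y (t₀ - s)) (-y' (t₀ - s)) (Icc 0 (t₀ - c)) s := by
      intro s hs
      have hs' : t₀ - s ∈ Icc c d := ⟨by linarith [hs.2], by linarith [hs.1, ht₀.2]⟩
      have h1 : HasDerivWithinAt (fun s : ℝ => t₀ - s) (-1) (Icc 0 (t₀ - c)) s := by
        simpa using! ((hasDerivAt_id s).const_sub t₀).hasDerivWithinAt
      have := (hy _ hs').scomp s h1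
        (fun r hr => ⟨by linarith [hr.2], by linarith [hr.1, ht₀.2]⟩)
      simpa using! this
    have := norm_le_gronwallBound_of_norm_deriv_right_le (f := fun s => y (t₀ - s))
      (f' := fun s => -y' (t₀ - s)) (δ := ‖y t₀‖)
      (K := K) (ε := 0) (a := 0) (b := t₀ - c)
      (fun s hs => (hz s hs).continuousWithinAt)
      (fun s hs => (hz s ⟨hs.1, hs.2.le⟩).mono_of_mem_nhdsWithin
        (mem_of_superset (Icc_mem_nhdsGE hs.2) (Icc_subset_Icc_left hs.1)))
      (by simp) (fun s hs => by
        simpa using! hle (t₀ - s) ⟨by linarith [hs.2], by linarith [hs.1, ht₀.2]⟩)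
      (t₀ - t) ⟨by linarith, by linarith [ht.1]⟩
    rw [gronwallBound_ε0] at this
    simp only [sub_sub_cancel, sub_zero] at this
    exact this.trans (hexp _ (by linarith [ht.1, ht₀.2]))

/-- Picard–Lindelöf needs a bounded field, so the linear field is precomposed with a cut-off at the
a priori Grönwall bound `R`. The cut-off does not increase norms, so its solution obeys the same
bound, never feels the cut-off, and solves the linear equation on the whole interval. -/
theorem exists_hasDerivWithinAt_linearField_Icc {q : ℝ → ℝ} {c d t₀ : ℝ} (ht₀ : t₀ ∈ Icc c d)
    (hq : ContinuousOn q (Icc c d)) (y₀ : ℝ × ℝ) :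
    ∃ y : ℝ → ℝ × ℝ, y t₀ = y₀ ∧
      ∀ t ∈ Icc c d, HasDerivWithinAt y (linearField q t (y t)) (Icc c d) t := by
  obtain ⟨M, hM⟩ := isCompact_Icc.exists_bound_of_continuousOn hq
  set K : ℝ≥0 := Real.toNNReal M + 1 with hKdef
  have hK1 : 1 ≤ K := le_add_self
  have hqK : ∀ t ∈ Icc c d, |q t| ≤ K := fun t ht =>
    (hM t ht).trans ((Real.le_coe_toNNReal M).trans (by simp [hKdef]))
  set R : ℝ≥0 := ⟨‖y₀‖ * Real.exp (K * (d - c)), by positivity⟩ with hR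
  have hlip : ∀ t ∈ Icc c d, LipschitzWith K (linearField q t) := fun t ht =>
    lipschitzWith_linearField hK1 (hqK t ht)
  have hnorm : ∀ t ∈ Icc c d, ∀ x, ‖linearField q t x‖ ≤ K * ‖x‖ := fun t ht x => by
    have := (hlip t ht).dist_le_mul x 0
    simpa [linearField, dist_eq_norm] using! this
  have hcd : c ≤ d := ht₀.1.trans ht₀.2
  -- The cut-off field is at most `K * R` in norm everywhere, so the ball may be given the radius `K
  -- * R * (d - c)` and no shortening of the interval is needed.
  have hPL : IsPicardLindelof (fun t x => linearField q t (clampPair R x)) (tmin := c)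
      (tmax := d) ⟨t₀, ht₀⟩ y₀ (K * R * ⟨d - c, sub_nonneg.2 hcd⟩) 0 (K * R) K :=
    { lipschitzOnWith := fun t ht => by
        simpa using! ((hlip t ht).comp (lipschitzWith_clampPair R)).lipschitzOnWith
      continuousOn := fun x _ => by
        unfold linearField
        fun_prop
      norm_le := fun t ht x _ => (hnorm t ht _).trans
        (mul_le_mul_of_nonneg_left (norm_clampPair_le R.2 x).1 K.2)
      mul_max_le := by
        push_cast
        simp only [sub_zero]
        refine mul_le_mul_of_nonneg_left ?_ (by positivity)
        exact max_le (sub_le_sub_left ht₀.1 d) (sub_le_sub_right ht₀.2 c) }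
  obtain ⟨y, hy0, hy⟩ := hPL.exists_eq_forall_mem_Icc_hasDerivWithinAt₀
  refine ⟨y, hy0, fun t ht => ?_⟩
  have hbound := norm_le_of_norm_deriv_le_mul ht₀ K.2 hy
    (fun t ht => (hnorm t ht _).trans
      (mul_le_mul_of_nonneg_left (norm_clampPair_le R.2 (y t)).2 K.2)) t ht
  have hyt := hy t ht
  simp only at hyt hy0
  rw [hy0] at hbound
  rwa [clampPair_of_norm_le (R := (R : ℝ)) hbound] at hyt

theorem eqOn_Ioo_of_hasDerivAt_linearField {q : ℝ → ℝ} {r a : ℝ}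
    (hq : ContinuousOn q (Icc (-r) r)) (ha : a ∈ Ioo (-r) r) {y z : ℝ → ℝ × ℝ}
    (hy : ∀ t ∈ Ioo (-r) r, HasDerivAt y (linearField q t (y t)) t)
    (hz : ∀ t ∈ Ioo (-r) r, HasDerivAt z (linearField q t (z t)) t) (h : y a = z a) :
    EqOn y z (Ioo (-r) r) := by
  obtain ⟨M, hM⟩ := isCompact_Icc.exists_bound_of_continuousOn hq
  exact ODE_solution_unique_of_mem_Ioo (K := Real.toNNReal M + 1) (s := fun _ => univ)
    (fun t ht => (lipschitzWith_linearField le_add_self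
      ((hM t (Ioo_subset_Icc_self ht)).trans
        ((Real.le_coe_toNNReal M).trans (by simp)))).lipschitzOnWith)
    ha (fun t ht => ⟨hy t ht, mem_univ _⟩) (fun t ht => ⟨hz t ht, mem_univ _⟩) h

/-- Solutions of `u'' + q u = 0` with given initial values exist on all of `(-1, 1)`. -/
theorem exists_solution_Ioo {q : ℝ → ℝ} (hq : ContinuousOn q (Ioo (-1) 1)) {a : ℝ}
    (ha : a ∈ Ioo (-1 : ℝ) 1) (u₀ v₀ : ℝ) :
    ∃ u v : ℝ → ℝ, u a = u₀ ∧ v a = v₀ ∧ (∀ x ∈ Ioo (-1 : ℝ) 1, HasDerivAt u (v x) x) ∧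
      ∀ x ∈ Ioo (-1 : ℝ) 1, HasDerivAt v (-(q x * u x)) x := by
  have ha' : |a| < 1 := abs_lt.2 ha
  have hex : ∀ r : ℝ, |a| < r → r < 1 → ∃ y : ℝ → ℝ × ℝ, y a = (u₀, v₀) ∧
      ∀ t ∈ Icc (-r) r, HasDerivWithinAt y (linearField q t (y t)) (Icc (-r) r) t :=
    fun r h1 h2 => exists_hasDerivWithinAt_linearField_Icc
      ⟨(abs_lt.1 h1).1.le, (abs_lt.1 h1).2.le⟩
      (hq.mono (Icc_subset_Ioo (by linarith) h2)) _
  choose! Y hY0 hY using hex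
  have hYd : ∀ r, |a| < r → r < 1 → ∀ t ∈ Ioo (-r) r,
      HasDerivAt (Y r) (linearField q t (Y r t)) t := fun r h1 h2 t ht =>
    (hY r h1 h2 t (Ioo_subset_Icc_self ht)).hasDerivAt (Icc_mem_nhds ht.1 ht.2)
  have hcons : ∀ r s, |a| < r → r ≤ s → s < 1 → EqOn (Y r) (Y s) (Ioo (-r) r) := by
    intro r s h1 h2 h3
    refine eqOn_Ioo_of_hasDerivAt_linearField
      (hq.mono (Icc_subset_Ioo (by linarith) (by linarith))) (abs_lt.1 h1)
      (hYd r h1 (by linarith)) (fun t ht => hYd s (by linarith) h3 t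
        ⟨by linarith [ht.1], by linarith [ht.2]⟩) ?_
    rw [hY0 r h1 (by linarith), hY0 s (by linarith) h3]
  -- The value at `x` is taken from the solution on `[-ρ x, ρ x]`, an interval inside `(-1, 1)` with
  -- both `x` and `a` in its interior; by uniqueness these solutions agree on overlaps.
  set ρ : ℝ → ℝ := fun x => (1 + max |x| |a|) / 2 with hρ
  have hρ1 : ∀ x ∈ Ioo (-1 : ℝ) 1, |a| < ρ x ∧ ρ x < 1 ∧ x ∈ Ioo (-ρ x) (ρ x) := by
    intro x hx
    have hx' : |x| < 1 := abs_lt.2 hx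
    have h1 := le_max_left |x| |a|
    have h2 := le_max_right |x| |a|
    have h3 := max_lt hx' ha'
    refine ⟨?_, ?_, abs_lt.1 ?_⟩ <;> simp only [hρ] <;> linarith
  have hmain : ∀ x ∈ Ioo (-1 : ℝ) 1,
      HasDerivAt (fun x => Y (ρ x) x) (linearField q x (Y (ρ x) x)) x := by
    intro x hx
    obtain ⟨h1, h2, h3⟩ := hρ1 x hx
    refine (hYd (ρ x) h1 h2 x h3).congr_of_eventuallyEq ?_
    filter_upwards [Ioo_mem_nhds h3.1 h3.2, Ioo_mem_nhds hx.1 hx.2] with t ht ht'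
    obtain ⟨h1', h2', h3'⟩ := hρ1 t ht'
    rcases le_total (ρ x) (ρ t) with h | h
    · exact (hcons _ _ h1 h h2' ht).symm
    · exact hcons _ _ h1' h h2 h3'
  obtain ⟨h1, h2, -⟩ := hρ1 a ha
  refine ⟨fun x => (Y (ρ x) x).1, fun x => (Y (ρ x) x).2, by simp [hY0 _ h1 h2],
    by simp [hY0 _ h1 h2], fun x hx => ?_, fun x hx => ?_⟩
  · exact hasFDerivAt_fst.comp_hasDerivAt x (hmain x hx)
  · exact hasFDerivAt_snd.comp_hasDerivAt x (hmain x hx)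

/-! ### Ahlfors Schwarzian of a curve and Sturm comparison -/

section Curve

variable {E : Type*} [NormedAddCommGroup E] [InnerProductSpace ℝ E]

/-- The Schwarzian of Ahlfors of a curve in an inner product space, as a function of its first
three derivatives. -/
noncomputable def curveSchwarzian (v₁ v₂ v₃ : E) : ℝ :=
  inner ℝ v₁ v₃ / ‖v₁‖ ^ 2 - 3 * (inner ℝ v₁ v₂ / ‖v₁‖ ^ 2) ^ 2 + 3 / 2 * (‖v₂‖ ^ 2 / ‖v₁‖ ^ 2)

/-- With `v₀ = γ - γ(a)` and `vᵢ` the derivatives of `γ`, the right side is `L' + L² = u'' / u` for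
`u = |γ - γ(a)| / √|γ'|` and `L = u' / u`. -/
theorem neg_curveSchwarzian_le {v₀ v₁ v₂ v₃ : E} (h₀ : v₀ ≠ 0) (h₁ : v₁ ≠ 0) :
    -(curveSchwarzian v₁ v₂ v₃ / 2) ≤
      ((‖v₁‖ ^ 2 + inner ℝ v₀ v₂) / ‖v₀‖ ^ 2 - 2 * (inner ℝ v₀ v₁ / ‖v₀‖ ^ 2) ^ 2
        - (‖v₂‖ ^ 2 + inner ℝ v₁ v₃) / (2 * ‖v₁‖ ^ 2) + (inner ℝ v₁ v₂ / ‖v₁‖ ^ 2) ^ 2)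
      + (inner ℝ v₀ v₁ / ‖v₀‖ ^ 2 - inner ℝ v₁ v₂ / (2 * ‖v₁‖ ^ 2)) ^ 2 := by
  have hN : 0 < ‖v₀‖ ^ 2 := by positivity
  have hM : 0 < ‖v₁‖ ^ 2 := by positivity
  -- The right side of the goal minus the left is exactly the Cauchy–Schwarz defect of this vector
  -- and `v₁`, divided by `‖v₁‖ ^ 4`.
  have hcs := real_inner_mul_inner_self_le
    ((1 / 2 : ℝ) • v₂ + (‖v₁‖ ^ 2 / ‖v₀‖ ^ 2) • v₀) v₁
  simp only [inner_add_left, inner_add_right, inner_smul_left, inner_smul_right,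
    real_inner_self_eq_norm_sq, RCLike.conj_to_real] at hcs
  rw [real_inner_comm v₀ v₂, real_inner_comm v₁ v₂] at hcs
  unfold curveSchwarzian
  generalize ‖v₀‖ ^ 2 = N at *
  generalize ‖v₁‖ ^ 2 = M at *
  generalize ‖v₂‖ ^ 2 = D at *
  generalize (inner ℝ v₀ v₁ : ℝ) = P at *
  generalize (inner ℝ v₀ v₂ : ℝ) = Q at *
  generalize (inner ℝ v₁ v₂ : ℝ) = R at *
  generalize (inner ℝ v₁ v₃ : ℝ) = T at *
  rw [← sub_nonneg] at hcs ⊢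
  have := div_nonneg hcs (sq_nonneg M)
  refine this.trans_eq ?_
  field_simp
  ring

theorem hasDerivAt_sqrt_normSq_div {g g₁ h h₁ : ℝ → E} {t : ℝ} (hg : HasDerivAt g (g₁ t) t)
    (hh : HasDerivAt h (h₁ t) t) (hg0 : g t ≠ 0) (hh0 : h t ≠ 0) :
    HasDerivAt (fun t => √(‖g t‖ ^ 2 / ‖h t‖))
      (√(‖g t‖ ^ 2 / ‖h t‖) *
        (inner ℝ (g t) (g₁ t) / ‖g t‖ ^ 2 - inner ℝ (h t) (h₁ t) / (2 * ‖h t‖ ^ 2))) t := by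
  have hN : 0 < ‖g t‖ := by positivity
  have hM : 0 < ‖h t‖ := by positivity
  have h1 := hg.norm_sq
  have h2 := hh.norm_sq.sqrt (pow_ne_zero 2 hM.ne')
  simp only [Real.sqrt_sq (norm_nonneg _)] at h2
  have h3 := (h1.div h2 hM.ne').sqrt (show ‖g t‖ ^ 2 / ‖h t‖ ≠ 0 by positivity)
  refine h3.congr_deriv ?_
  simp only [Pi.div_apply]
  have hpos : 0 < ‖g t‖ ^ 2 / ‖h t‖ := by positivity
  have hs := Real.sq_sqrt hpos.le
  have hs0 := Real.sqrt_pos.2 hpos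
  generalize √(‖g t‖ ^ 2 / ‖h t‖) = s at *
  rw [div_eq_iff (by positivity)]
  have : ∀ X : ℝ, s * X * (2 * s) = 2 * X * s ^ 2 := fun X => by ring
  rw [this, hs]
  field_simp

/-- The positive slope at `a` makes `y` positive at points arbitrarily close to `a`; a later
negative value would force a zero in between. -/
theorem forall_Ioo_pos_of_forall_ne_zero {y y' : ℝ → ℝ} {a b : ℝ} (hab : a < b)
    (hy : ∀ x ∈ Ico a b, HasDerivAt y (y' x) x) (ha : y a = 0) (ha' : 0 < y' a)
    (hne : ∀ x ∈ Ioo a b, y x ≠ 0) : ∀ x ∈ Ioo a b, 0 < y x := by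
  intro x hx
  by_contra hneg
  have hx0 : y x < 0 := lt_of_le_of_ne (not_lt.1 hneg) (hne x hx)
  have hslope := (hasDerivAt_iff_tendsto_slope.1 (hy a ⟨le_rfl, hab⟩)).mono_left
    (nhdsWithin_mono a (show Ioi a ⊆ {a}ᶜ from fun z hz => ne_of_gt hz))
  obtain ⟨c, hc, hcx⟩ := ((hslope.eventually (lt_mem_nhds ha')).and
    (Ioo_mem_nhdsGT hx.1)).exists
  have hyc : 0 < y c := by
    rw [slope_def_field, ha, sub_zero] at hc
    exact (div_pos_iff_of_pos_right (sub_pos.2 hcx.1)).1 hc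
  have hcont : ContinuousOn y (Icc c x) := fun z hz =>
    (hy z ⟨hcx.1.le.trans hz.1, hz.2.trans_lt hx.2⟩).continuousAt.continuousWithinAt
  obtain ⟨z, hz, hz0⟩ := intermediate_value_Icc' hcx.2.le hcont ⟨hx0.le, hyc.le⟩
  exact hne z ⟨hcx.1.trans_le hz.1, hz.2.trans_lt hx.2⟩ hz0

/-- Sturm comparison: if `u'' + p u ≥ 0` (with `u' = u L`) and `y'' + p y = 0` on `(a, b)`, both
are positive there and `u' y - u y' → 0` at `a`, then `u` cannot vanish at `b`
unless `y` does. -/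
theorem sturm_comparison {u L L' y y' p : ℝ → ℝ} {a b : ℝ} (hab : a < b)
    (hu : ∀ t ∈ Ioo a b, HasDerivAt u (u t * L t) t)
    (hL : ∀ t ∈ Ioo a b, HasDerivAt L (L' t) t)
    (hy : ∀ t ∈ Ioo a b, HasDerivAt y (y' t) t)
    (hy' : ∀ t ∈ Ioo a b, HasDerivAt y' (-(p t * y t)) t)
    (hupos : ∀ t ∈ Ioo a b, 0 < u t) (hypos : ∀ t ∈ Ioo a b, 0 < y t)
    (hle : ∀ t ∈ Ioo a b, -p t ≤ L' t + L t ^ 2)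
    (hlim : Tendsto (fun t => u t * (L t * y t - y' t)) (𝓝[>] a) (𝓝 0))
    (hub : ContinuousAt u b) (hyb : ContinuousAt y b) (hyb0 : 0 < y b) : 0 < u b := by
  -- The Wronskian `u' y - u y'` has derivative `y (u'' + p u) ≥ 0` and limit `0` at `a`, so it is
  -- non-negative; divided by `y²` it is the derivative of `u / y`.
  have hW : ∀ t ∈ Ioo a b, HasDerivAt (fun t => u t * (L t * y t - y' t))
      (u t * y t * (L' t + L t ^ 2 + p t)) t := by
    intro t ht
    refine ((hu t ht).mul (((hL t ht).mul (hy t ht)).sub (hy' t ht))).congr_deriv ?_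
    simp only [Pi.sub_apply, Pi.mul_apply]
    ring
  have hmono : MonotoneOn (fun t => u t * (L t * y t - y' t)) (Ioo a b) := by
    refine monotoneOn_of_hasDerivWithinAt_nonneg (convex_Ioo a b)
      (HasDerivAt.continuousOn hW) (fun t ht => (hW t (interior_subset ht)).hasDerivWithinAt)
      fun t ht => ?_
    have ht' := interior_subset ht
    have := hle t ht'
    exact mul_nonneg (mul_pos (hupos t ht') (hypos t ht')).le (by linarith)
  have hWnn : ∀ t ∈ Ioo a b, 0 ≤ u t * (L t * y t - y' t) := fun t ht =>
    le_of_tendsto hlim (mem_of_superset (Ioo_mem_nhdsGT ht.1) fun s hs =>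
      hmono ⟨hs.1, hs.2.trans ht.2⟩ ht hs.2.le)
  have hq : ∀ t ∈ Ioo a b, HasDerivAt (fun t => u t / y t)
      (u t * (L t * y t - y' t) / y t ^ 2) t := fun t ht => by
    refine ((hu t ht).div (hy t ht) (hypos t ht).ne').congr_deriv ?_
    congr 1
    ring
  have hqmono : MonotoneOn (fun t => u t / y t) (Ioo a b) :=
    monotoneOn_of_hasDerivWithinAt_nonneg (convex_Ioo a b)
      (HasDerivAt.continuousOn hq) (fun t ht => (hq t (interior_subset ht)).hasDerivWithinAt)
      fun t ht => div_nonneg (hWnn t (interior_subset ht)) (sq_nonneg _)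
  obtain ⟨c, hc⟩ := exists_between hab
  have hlimb : Tendsto (fun t => u t / y t) (𝓝[<] b) (𝓝 (u b / y b)) :=
    (hub.div hyb hyb0.ne').mono_left nhdsWithin_le_nhds
  have h1 : u c / y c ≤ u b / y b :=
    ge_of_tendsto hlimb (mem_of_superset (Ioo_mem_nhdsLT hc.2) fun s hs =>
      hqmono hc ⟨hc.1.trans hs.1, hs.2⟩ hs.1.le)
  have h2 : 0 < u b / y b := (div_pos (hupos c hc) (hypos c hc)).trans_le h1
  exact (div_pos_iff_of_pos_right hyb0).1 h2

/-- The nonzero derivative isolates `a` among the parameters with value `γ a`; beyond the isolating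
interval those parameters form a compact set, which has a least element. -/
theorem exists_first_return {γ : ℝ → E} {v : E} {a b : ℝ} (hab : a < b)
    (hγ : ContinuousOn γ (Icc a b)) (ha : HasDerivAt γ v a) (hv : v ≠ 0) (h : γ a = γ b) :
    ∃ c ∈ Ioc a b, γ c = γ a ∧ ∀ t ∈ Ioo a c, γ t ≠ γ a := by
  have hev : ∀ᶠ t in 𝓝[>] a, γ t ≠ γ a :=
    (ha.eventually_ne (c := γ a) hv).filter_mono
      (nhdsWithin_mono a (show Ioi a ⊆ {a}ᶜ from fun z hz => ne_of_gt hz))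
  obtain ⟨d, hd, hdne⟩ := (mem_nhdsGT_iff_exists_Ioo_subset).1 hev
  have hdb : d ≤ b := not_lt.1 fun hlt => hdne ⟨hab, hlt⟩ h.symm
  have hcont : ContinuousOn γ (Icc d b) := hγ.mono (Icc_subset_Icc_left (le_of_lt hd))
  have hcpt : IsCompact (Icc d b ∩ γ ⁻¹' {γ a}) :=
    isCompact_Icc.of_isClosed_subset
      (hcont.preimage_isClosed_of_isClosed isClosed_Icc isClosed_singleton) inter_subset_left
  obtain ⟨c, ⟨hc1, hc2⟩, hc3⟩ := hcpt.exists_isLeast ⟨b, ⟨hdb, le_rfl⟩, h.symm⟩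
  refine ⟨c, ⟨lt_of_lt_of_le hd hc1.1, hc1.2⟩, hc2, fun t ht hta => ?_⟩
  rcases lt_or_ge t d with htd | htd
  · exact hdne ⟨ht.1, htd⟩ hta
  · exact absurd (hc3 ⟨⟨htd, ht.2.le.trans hc1.2⟩, hta⟩) (not_le.2 ht.2)

/-- A curve whose Ahlfors Schwarzian is at most `2 p`, for a Nehari function `p`, is injective. -/
theorem injOn_of_curveSchwarzian_le {p : ℝ → ℝ} (hp : IsNehari p) {γ γ₁ γ₂ γ₃ : ℝ → E}
    (h₀ : ∀ t ∈ Ioo (-1 : ℝ) 1, HasDerivAt γ (γ₁ t) t)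
    (h₁ : ∀ t ∈ Ioo (-1 : ℝ) 1, HasDerivAt γ₁ (γ₂ t) t)
    (h₂ : ∀ t ∈ Ioo (-1 : ℝ) 1, HasDerivAt γ₂ (γ₃ t) t)
    (hne : ∀ t ∈ Ioo (-1 : ℝ) 1, γ₁ t ≠ 0)
    (hS : ∀ t ∈ Ioo (-1 : ℝ) 1, curveSchwarzian (γ₁ t) (γ₂ t) (γ₃ t) ≤ 2 * p t) :
    InjOn γ (Ioo (-1) 1) := by
  suffices H : ∀ a ∈ Ioo (-1 : ℝ) 1, ∀ b ∈ Ioo (-1 : ℝ) 1, a < b → γ a ≠ γ b by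
    intro a ha b hb hab
    by_contra hne'
    rcases lt_or_gt_of_ne hne' with h | h
    · exact H a ha b hb h hab
    · exact H b hb a ha h hab.symm
  intro a ha b' hb' hab' heq
  -- Stopping at the first return keeps `γ t - γ a` nonzero on `(a, b)`, so the logarithmic
  -- derivative of `u` is available there.
  obtain ⟨b, hb1, hb2, hb3⟩ := exists_first_return hab' (fun t ht =>
    (h₀ t ⟨ha.1.trans_le ht.1, ht.2.trans_lt hb'.2⟩).continuousAt.continuousWithinAt)
    (h₀ a ha) (hne a ha) heq
  have hab : a < b := hb1.1
  have hb : b ∈ Ioo (-1 : ℝ) 1 := ⟨ha.1.trans hab, hb1.2.trans_lt hb'.2⟩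
  have hsub : ∀ t ∈ Ioo a b, t ∈ Ioo (-1 : ℝ) 1 := fun t ht =>
    ⟨ha.1.trans ht.1, ht.2.trans hb.2⟩
  obtain ⟨y, y', hya, hya', hy, hy'⟩ := exists_solution_Ioo hp.continuousOn ha 0 1
  -- A second zero would make `y` vanish identically, against `y' a = 1`.
  have hyne : ∀ x ∈ Ioo a 1, y x ≠ 0 := by
    intro x hx hx0
    have hzero := hp.disconjugate y y' hy hy' a ha x ⟨ha.1.trans hx.1, hx.2⟩ hx.1.ne hya hx0
    have h1 : HasDerivAt y 0 a := (hasDerivAt_const a (0 : ℝ)).congr_of_eventuallyEq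
      (mem_of_superset (Ioo_mem_nhds ha.1 ha.2) hzero)
    have := h1.unique (hy a ha)
    rw [hya'] at this
    exact zero_ne_one this
  have hypos := forall_Ioo_pos_of_forall_ne_zero ha.2 (fun x hx => hy x ⟨ha.1.trans_le hx.1, hx.2⟩) hya
    (by rw [hya']; exact one_pos) hyne
  set u : ℝ → ℝ := fun t => √(‖γ t - γ a‖ ^ 2 / ‖γ₁ t‖) with hu
  set L : ℝ → ℝ := fun t => inner ℝ (γ t - γ a) (γ₁ t) / ‖γ t - γ a‖ ^ 2
    - inner ℝ (γ₁ t) (γ₂ t) / (2 * ‖γ₁ t‖ ^ 2) with hLdef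
  have hg : ∀ t ∈ Ioo (-1 : ℝ) 1, HasDerivAt (fun t => γ t - γ a) (γ₁ t) t :=
    fun t ht => (h₀ t ht).sub_const _
  have hucont : ∀ t ∈ Ioo (-1 : ℝ) 1, ContinuousAt u t := fun t ht =>
    (((hg t ht).continuousAt.norm.pow 2).div (h₁ t ht).continuousAt.norm
      (norm_ne_zero_iff.2 (hne t ht))).sqrt
  have hua : u a = 0 := by simp [hu]
  refine (sturm_comparison (u := u) (L := L) (L' := fun t =>
    (‖γ₁ t‖ ^ 2 + inner ℝ (γ t - γ a) (γ₂ t)) / ‖γ t - γ a‖ ^ 2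
      - 2 * (inner ℝ (γ t - γ a) (γ₁ t) / ‖γ t - γ a‖ ^ 2) ^ 2
      - (‖γ₂ t‖ ^ 2 + inner ℝ (γ₁ t) (γ₃ t)) / (2 * ‖γ₁ t‖ ^ 2)
      + (inner ℝ (γ₁ t) (γ₂ t) / ‖γ₁ t‖ ^ 2) ^ 2) (p := p) hab (fun t ht => ?_) (fun t ht => ?_)
    (fun t ht => hy t (hsub t ht)) (fun t ht => hy' t (hsub t ht)) (fun t ht => ?_)
    (fun t ht => hypos t ⟨ht.1, ht.2.trans hb.2⟩) (fun t ht => ?_) ?_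
    (hucont b hb) (hy b hb).continuousAt (hypos b ⟨hab, hb.2⟩)).ne' (by simp [hu, hb2])
  · exact hasDerivAt_sqrt_normSq_div (hg t (hsub t ht)) (h₁ t (hsub t ht))
      (sub_ne_zero.2 (hb3 t ht)) (hne t (hsub t ht))
  · have ht' := hsub t ht
    have hN : 0 < ‖γ t - γ a‖ := norm_pos_iff.2 (sub_ne_zero.2 (hb3 t ht))
    have hM : 0 < ‖γ₁ t‖ := norm_pos_iff.2 (hne t ht')
    have hM2 : 2 * ‖γ₁ t‖ ^ 2 ≠ 0 := by positivity
    refine ((((hg t ht').inner ℝ (h₁ t ht')).div (hg t ht').norm_sq (by positivity)).sub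
      (((h₁ t ht').inner ℝ (h₂ t ht')).div ((h₁ t ht').norm_sq.const_mul 2) hM2)).congr_deriv ?_
    simp only [real_inner_self_eq_norm_sq]
    field_simp
    ring
  · have : 0 < ‖γ t - γ a‖ := norm_pos_iff.2 (sub_ne_zero.2 (hb3 t ht))
    have : 0 < ‖γ₁ t‖ := norm_pos_iff.2 (hne t (hsub t ht))
    exact Real.sqrt_pos.2 (by positivity)
  · have h1 := neg_curveSchwarzian_le (v₂ := γ₂ t) (v₃ := γ₃ t) (sub_ne_zero.2 (hb3 t ht))
      (hne t (hsub t ht))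
    have h2 := hS t (hsub t ht)
    exact le_trans (by linarith) h1
  · have hM : ‖γ₁ a‖ ≠ 0 := norm_ne_zero_iff.2 (hne a ha)
    -- A majorant of the Wronskian near `a`, continuous there with value `0`. It avoids
    -- differentiating `u` at its zero `a`.
    have hB : ContinuousAt (fun t => (√‖γ₁ t‖ + u t * |inner ℝ (γ₁ t) (γ₂ t) / (2 * ‖γ₁ t‖ ^ 2)|)
        * |y t| + u t * |y' t|) a := by
      have c1 := (h₁ a ha).continuousAt
      have c2 := (h₂ a ha).continuousAt
      have c3 := (hy a ha).continuousAt
      have c4 := (hy' a ha).continuousAt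
      have c5 := hucont a ha
      exact ((c1.norm.sqrt.add (c5.mul ((c1.inner c2).div ((c1.norm.pow 2).const_mul 2)
        (mul_ne_zero two_ne_zero (pow_ne_zero 2 hM))).abs)).mul c3.abs).add (c5.mul c4.abs)
    have hB0 := hB.tendsto
    simp only [hua, hya, abs_zero, mul_zero, zero_mul, add_zero] at hB0
    refine squeeze_zero_norm' ?_ (hB0.mono_left nhdsWithin_le_nhds)
    filter_upwards [Ioo_mem_nhdsGT hab] with t ht
    have hN : 0 < ‖γ t - γ a‖ := norm_pos_iff.2 (sub_ne_zero.2 (hb3 t ht))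
    have hM : 0 < ‖γ₁ t‖ := norm_pos_iff.2 (hne t (hsub t ht))
    have hut : 0 ≤ u t := Real.sqrt_nonneg _
    have hu2 : u t ^ 2 = ‖γ t - γ a‖ ^ 2 / ‖γ₁ t‖ := Real.sq_sqrt (by positivity)
    -- The term of `L` that is singular at `a` stays bounded after multiplication by `u`, by
    -- Cauchy–Schwarz.
    have key : |u t * (inner ℝ (γ t - γ a) (γ₁ t) / ‖γ t - γ a‖ ^ 2)| ≤ √‖γ₁ t‖ := by
      refine Real.abs_le_sqrt ?_
      have hcs : inner ℝ (γ t - γ a) (γ₁ t) ^ 2 ≤ (‖γ t - γ a‖ * ‖γ₁ t‖) ^ 2 :=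
        sq_le_sq' (neg_le_of_abs_le (abs_real_inner_le_norm _ _)) (real_inner_le_norm _ _)
      rw [mul_pow, hu2, div_pow]
      calc ‖γ t - γ a‖ ^ 2 / ‖γ₁ t‖ * (inner ℝ (γ t - γ a) (γ₁ t) ^ 2 / (‖γ t - γ a‖ ^ 2) ^ 2)
          ≤ ‖γ t - γ a‖ ^ 2 / ‖γ₁ t‖ *
            ((‖γ t - γ a‖ * ‖γ₁ t‖) ^ 2 / (‖γ t - γ a‖ ^ 2) ^ 2) := by gcongr
        _ = ‖γ₁ t‖ := by field_simp
    have e : u t * (L t * y t - y' t) =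
        (u t * (inner ℝ (γ t - γ a) (γ₁ t) / ‖γ t - γ a‖ ^ 2)
          - u t * (inner ℝ (γ₁ t) (γ₂ t) / (2 * ‖γ₁ t‖ ^ 2))) * y t - u t * y' t := by
      simp only [hLdef]
      ring
    rw [Real.norm_eq_abs, e]
    refine (abs_sub _ _).trans ?_
    rw [abs_mul, abs_mul (u t) (y' t), abs_of_nonneg hut]
    gcongr
    refine (abs_sub _ _).trans ?_
    rw [abs_mul (u t) (_ / (2 * _)), abs_of_nonneg hut]
    gcongr

end Curve

/-! ### Real and Wirtinger derivatives; curvature of a conformal metric -/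

theorem real_inner_eq_re_inner_euclidean {n : ℕ} (x y : EuclideanSpace ℂ (Fin n)) :
    inner ℝ x y = (inner ℂ x y).re := by
  simp [PiLp.inner_apply, Complex.re_sum, Complex.inner]

/-- The real differential `h ↦ h v` of a holomorphic map with derivative `v`. -/
noncomputable def smulDifferential {F : Type*} [NormedAddCommGroup F] [NormedSpace ℝ F] [NormedSpace ℂ F]
    [IsScalarTower ℝ ℂ F] (v : F) : ℂ →L[ℝ] F :=
  (ContinuousLinearMap.toSpanSingleton ℂ v).restrictScalars ℝ

theorem smulDifferential_apply {F : Type*} [NormedAddCommGroup F] [NormedSpace ℝ F] [NormedSpace ℂ F]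
    [IsScalarTower ℝ ℂ F] (v : F) (h : ℂ) : smulDifferential v h = h • v := rfl

theorem hasFDerivAt_smulDifferential {F : Type*} [NormedAddCommGroup F] [NormedSpace ℝ F]
    [NormedSpace ℂ F] [IsScalarTower ℝ ℂ F] {f : ℂ → F} {v : F} {z : ℂ} (h : HasDerivAt f v z) :
    HasFDerivAt f (smulDifferential v) z :=
  h.hasFDerivAt.restrictScalars ℝ

section Wirtinger

variable {F : Type*} [NormedAddCommGroup F] [NormedSpace ℝ F]

theorem dx_eq {g : ℂ → F} {g' : ℂ →L[ℝ] F} {z : ℂ} (h : HasFDerivAt g g' z) :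
    dx g z = g' 1 := by
  rw [dx, h.fderiv]

theorem dy_eq {g : ℂ → F} {g' : ℂ →L[ℝ] F} {z : ℂ} (h : HasFDerivAt g g' z) :
    dy g z = g' I := by
  rw [dy, h.fderiv]

theorem dz_eq {g : ℂ → ℂ} {g' : ℂ →L[ℝ] ℂ} {z : ℂ} (h : HasFDerivAt g g' z) :
    dz g z = (g' 1 - I * g' I) / 2 := by
  rw [dz, dx_eq h, dy_eq h]

theorem dx_congr {f g : ℂ → F} {z : ℂ} (h : f =ᶠ[𝓝 z] g) : dx f z = dx g z := by
  rw [dx, dx, h.fderiv_eq]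

theorem dy_congr {f g : ℂ → F} {z : ℂ} (h : f =ᶠ[𝓝 z] g) : dy f z = dy g z := by
  rw [dy, dy, h.fderiv_eq]

theorem dz_congr {f g : ℂ → ℂ} {z : ℂ} (h : f =ᶠ[𝓝 z] g) : dz f z = dz g z := by
  rw [dz, dz, dx_congr h, dy_congr h]

theorem dx_const (c : F) (z : ℂ) : dx (fun _ => c) z = 0 := by simp [dx]

theorem dy_const (c : F) (z : ℂ) : dy (fun _ => c) z = 0 := by simp [dy]

end Wirtinger

/-- For `E = G = l` and `F = 0`, Brioschi's formula reduces to `-Δ(log l) / (2 l)`, here with the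
logarithm expanded. -/
theorem metricCurvature_of_conformal {E F G l : ℂ → ℝ} {z : ℂ} (hE : E =ᶠ[𝓝 z] l)
    (hF : F =ᶠ[𝓝 z] fun _ => 0) (hG : G =ᶠ[𝓝 z] l) (hl : l z ≠ 0) :
    metricCurvature E F G z = (-(1 / 2) * l z * (dx (dx l) z + dy (dy l) z)
      + 1 / 2 * (dx l z ^ 2 + dy l z ^ 2)) / l z ^ 3 := by
  have e1 : dy (dy E) z = dy (dy l) z :=
    dy_congr (hE.eventuallyEq_nhds.mono fun _ h => dy_congr h)
  have e2 : dx (dx G) z = dx (dx l) z :=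
    dx_congr (hG.eventuallyEq_nhds.mono fun _ h => dx_congr h)
  have e3 : dx (dy F) z = 0 := by
    rw [dx_congr (hF.eventuallyEq_nhds.mono fun _ h => (dy_congr h).trans (dy_const 0 _)),
      dx_const]
  have e4 : dx F z = 0 := (dx_congr hF).trans (dx_const 0 z)
  have e5 : dy F z = 0 := (dy_congr hF).trans (dy_const 0 z)
  simp only [metricCurvature, e1, e2, e3, e4, e5, dx_congr hE, dy_congr hE, dx_congr hG,
    dy_congr hG, hE.self_of_nhds, hF.self_of_nhds, hG.self_of_nhds, Matrix.det_fin_three]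
  simp
  field_simp
  ring

/-! ### Schwarzian and curvature of a holomorphic curve -/

section Derivatives

variable {n : ℕ} {φ φ₁ φ₂ φ₃ : ℂ → EuclideanSpace ℂ (Fin n)} {z : ℂ}

/-- The inner product is conjugate-linear in its first slot, so `∂_z` of it differentiates only the
second holomorphic factor. -/
theorem hasFDerivAt_inner_holomorphic {f g : ℂ → EuclideanSpace ℂ (Fin n)}
    {f' g' : EuclideanSpace ℂ (Fin n)} (hf : HasDerivAt f f' z) (hg : HasDerivAt g g' z) :
    ∃ D : ℂ →L[ℝ] ℂ, HasFDerivAt (fun w => inner ℂ (f w) (g w)) D z ∧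
      ∀ h, D h = h * inner ℂ (f z) g' + (starRingEnd ℂ) h * inner ℂ f' (g z) := by
  refine ⟨_, (hasFDerivAt_smulDifferential hf).inner ℂ (hasFDerivAt_smulDifferential hg),
    fun h => ?_⟩
  simp [fderivInnerCLM_apply, smulDifferential_apply, inner_smul_left, inner_smul_right]

theorem hasFDerivAt_normSq_holomorphic {f : ℂ → EuclideanSpace ℂ (Fin n)}
    {f' : EuclideanSpace ℂ (Fin n)} (hf : HasDerivAt f f' z) :
    ∃ D : ℂ →L[ℝ] ℝ, HasFDerivAt (fun w => ‖f w‖ ^ 2) D z ∧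
      ∀ h, D h = 2 * (h * inner ℂ (f z) f').re := by
  refine ⟨_, (hasFDerivAt_smulDifferential hf).norm_sq, fun h => ?_⟩
  simp [smulDifferential_apply, real_inner_eq_re_inner_euclidean]

theorem hasDerivAt_coord {f : ℂ → EuclideanSpace ℂ (Fin n)}
    {f' : EuclideanSpace ℂ (Fin n)} (hf : HasDerivAt f f' z) (k : Fin n) :
    HasDerivAt (fun w => f w k) (f' k) z :=
  (EuclideanSpace.proj (𝕜 := ℂ) k).hasFDerivAt.comp_hasDerivAt z hf

theorem logFactor_eq (h : HasDerivAt φ (φ₁ z) z) :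
    logFactor φ z = 1 / 2 * Real.log (‖φ₁ z‖ ^ 2) := by
  rw [logFactor, EuclideanSpace.norm_sq_eq]
  simp only [(hasDerivAt_coord h _).deriv]

theorem dz_logFactor (h₀ : ∀ᶠ w in 𝓝 z, HasDerivAt φ (φ₁ w) w) (h₁ : HasDerivAt φ₁ (φ₂ z) z)
    (hne : φ₁ z ≠ 0) :
    dz (fun w => (logFactor φ w : ℂ)) z
      = 1 / 2 * (inner ℂ (φ₁ z) (φ₂ z) / ((‖φ₁ z‖ ^ 2 : ℝ) : ℂ)) := by
  obtain ⟨D, hD, hDv⟩ := hasFDerivAt_normSq_holomorphic h₁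
  have hl : ‖φ₁ z‖ ^ 2 ≠ 0 := pow_ne_zero 2 (norm_ne_zero_iff.2 hne)
  have h2 : HasFDerivAt (fun w => ((1 / 2 * Real.log (‖φ₁ w‖ ^ 2) : ℝ) : ℂ)) _ z :=
    ofRealCLM.hasFDerivAt.comp z ((hD.log hl).const_mul (1 / 2))
  have h3 : (fun w => (logFactor φ w : ℂ)) =ᶠ[𝓝 z]
      fun w => ((1 / 2 * Real.log (‖φ₁ w‖ ^ 2) : ℝ) : ℂ) :=
    h₀.mono fun w hw => by simp only [logFactor_eq hw]
  rw [dz_congr h3, dz_eq h2]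
  simp [hDv]
  field_simp
  rw [mul_comm I, re_add_im]

theorem schwarzian_eq (h₀ : ∀ᶠ w in 𝓝 z, HasDerivAt φ (φ₁ w) w)
    (h₁ : ∀ᶠ w in 𝓝 z, HasDerivAt φ₁ (φ₂ w) w) (h₂ : HasDerivAt φ₂ (φ₃ z) z)
    (hne : φ₁ z ≠ 0) :
    schwarzian φ z = inner ℂ (φ₁ z) (φ₃ z) / ((‖φ₁ z‖ ^ 2 : ℝ) : ℂ)
      - 3 / 2 * (inner ℂ (φ₁ z) (φ₂ z) / ((‖φ₁ z‖ ^ 2 : ℝ) : ℂ)) ^ 2 := by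
  have hne' : ∀ᶠ w in 𝓝 z, φ₁ w ≠ 0 := h₁.self_of_nhds.continuousAt.eventually_ne hne
  have hev : dz (fun w => (logFactor φ w : ℂ)) =ᶠ[𝓝 z] fun w =>
      1 / 2 * (inner ℂ (φ₁ w) (φ₂ w) * (((‖φ₁ w‖ ^ 2)⁻¹ : ℝ) : ℂ)) := by
    filter_upwards [h₀.eventually_nhds, h₁, hne'] with w hw0 hw1 hw2
    rw [dz_logFactor hw0 hw1 hw2, ofReal_inv, div_eq_mul_inv (inner ℂ (φ₁ w) (φ₂ w))]
  have hl : ‖φ₁ z‖ ^ 2 ≠ 0 := pow_ne_zero 2 (norm_ne_zero_iff.2 hne)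
  obtain ⟨D, hD, hDv⟩ := hasFDerivAt_normSq_holomorphic h₁.self_of_nhds
  obtain ⟨D', hD', hDv'⟩ := hasFDerivAt_inner_holomorphic h₁.self_of_nhds h₂
  have hinv := ofRealCLM.hasFDerivAt.comp z ((hasDerivAt_inv hl).comp_hasFDerivAt z hD)
  have h3 := (hD'.mul hinv).const_mul (1 / 2 : ℂ)
  have e : dz (fun w => 1 / 2 * (inner ℂ (φ₁ w) (φ₂ w) * (((‖φ₁ w‖ ^ 2)⁻¹ : ℝ) : ℂ))) z
      = 1 / 2 * (inner ℂ (φ₁ z) (φ₃ z) / ((‖φ₁ z‖ ^ 2 : ℝ) : ℂ)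
        - (inner ℂ (φ₁ z) (φ₂ z) / ((‖φ₁ z‖ ^ 2 : ℝ) : ℂ)) ^ 2) := by
    have hl' : ((‖φ₁ z‖ : ℝ) : ℂ) ≠ 0 := ofReal_ne_zero.2 (norm_ne_zero_iff.2 hne)
    refine (dz_eq h3).trans ?_
    simp [hDv, hDv']
    generalize (inner ℂ (φ₁ z) (φ₂ z) : ℂ) = b
    have hb : ((b.re : ℝ) : ℂ) + b.im * I = b := re_add_im b
    field_simp
    linear_combination (-2 * b) * hb
      + (‖φ₁ z‖ : ℂ) ^ 2 * ((‖φ₂ z‖ : ℂ) ^ 2 - inner ℂ (φ₁ z) (φ₃ z)) * I_sq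
  rw [schwarzian, dz_congr hev, e, hev.self_of_nhds]
  simp only [ofReal_inv]
  ring

/-- Since `φ_y = i φ_x`, the induced metric is conformal with factor `l = |φ'|²`, and `l_z = ⟨φ',
φ''⟩`. -/
theorem gaussianCurvature_eq (h₀ : ∀ᶠ w in 𝓝 z, HasDerivAt φ (φ₁ w) w)
    (h₁ : ∀ᶠ w in 𝓝 z, HasDerivAt φ₁ (φ₂ w) w) (h₂ : HasDerivAt φ₂ (φ₃ z) z)
    (hne : φ₁ z ≠ 0) :
    gaussianCurvature φ z =
      -2 * (‖φ₁ z‖ ^ 2 * ‖φ₂ z‖ ^ 2 - ‖inner ℂ (φ₁ z) (φ₂ z)‖ ^ 2) / (‖φ₁ z‖ ^ 2) ^ 3 := by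
  have hl : ‖φ₁ z‖ ^ 2 ≠ 0 := pow_ne_zero 2 (norm_ne_zero_iff.2 hne)
  have hdx : ∀ᶠ w in 𝓝 z, dx φ w = φ₁ w := h₀.mono fun w hw => by
    rw [dx_eq (hasFDerivAt_smulDifferential hw), smulDifferential_apply, one_smul]
  have hdy : ∀ᶠ w in 𝓝 z, dy φ w = I • φ₁ w := h₀.mono fun w hw => by
    rw [dy_eq (hasFDerivAt_smulDifferential hw), smulDifferential_apply]
  rw [gaussianCurvature, metricCurvature_of_conformal (l := fun w => ‖φ₁ w‖ ^ 2)
    (hdx.mono fun w hw => by simp only [hw, real_inner_self_eq_norm_sq])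
    (by
      filter_upwards [hdx, hdy] with w hw hw'
      rw [hw, hw', real_inner_eq_re_inner_euclidean, inner_smul_right, inner_self_eq_norm_sq_to_K]
      simp [← ofReal_pow])
    (hdy.mono fun w hw => by
      simp only [hw, real_inner_self_eq_norm_sq, norm_smul, norm_I, one_mul]) hl]
  have hdxl : dx (fun w => ‖φ₁ w‖ ^ 2) =ᶠ[𝓝 z] fun w => 2 * (inner ℂ (φ₁ w) (φ₂ w)).re := by
    filter_upwards [h₁] with w hw
    obtain ⟨D, hD, hDv⟩ := hasFDerivAt_normSq_holomorphic hw
    rw [dx_eq hD, hDv, one_mul]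
  have hdyl : dy (fun w => ‖φ₁ w‖ ^ 2) =ᶠ[𝓝 z] fun w => -2 * (inner ℂ (φ₁ w) (φ₂ w)).im := by
    filter_upwards [h₁] with w hw
    obtain ⟨D, hD, hDv⟩ := hasFDerivAt_normSq_holomorphic hw
    rw [dy_eq hD, hDv, I_mul_re]
    ring
  obtain ⟨D', hD', hDv'⟩ := hasFDerivAt_inner_holomorphic h₁.self_of_nhds h₂
  have hxx : HasFDerivAt (fun w => 2 * (inner ℂ (φ₁ w) (φ₂ w)).re) _ z :=
    (reCLM.hasFDerivAt.comp z hD').const_mul 2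
  have hyy : HasFDerivAt (fun w => -2 * (inner ℂ (φ₁ w) (φ₂ w)).im) _ z :=
    (imCLM.hasFDerivAt.comp z hD').const_mul (-2)
  rw [dx_congr hdxl, dy_congr hdyl, hdxl.self_of_nhds, hdyl.self_of_nhds, dx_eq hxx, dy_eq hyy]
  simp [hDv', ← normSq_eq_norm_sq, normSq_apply, inner_self_eq_norm_sq_to_K, ← ofReal_pow]
  ring

end Derivatives

/-! ### Relation to the Ahlfors Schwarzian, and change of parameter -/

section Chain

variable {n : ℕ}

/-- The Schwarzian of a holomorphic curve in terms of its first three derivatives. -/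
noncomputable def schwarzianForm (v₁ v₂ v₃ : EuclideanSpace ℂ (Fin n)) : ℂ :=
  inner ℂ v₁ v₃ / ((‖v₁‖ ^ 2 : ℝ) : ℂ)
    - 3 / 2 * (inner ℂ v₁ v₂ / ((‖v₁‖ ^ 2 : ℝ) : ℂ)) ^ 2

/-- The square of the length of the component of `v₂` orthogonal to the complex line of `v₁`,
relative to that of `v₁`. -/
noncomputable def normalForm (v₁ v₂ : EuclideanSpace ℂ (Fin n)) : ℝ :=
  (‖v₁‖ ^ 2 * ‖v₂‖ ^ 2 - ‖(inner ℂ v₁ v₂ : ℂ)‖ ^ 2) / (‖v₁‖ ^ 2) ^ 2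

theorem normalForm_nonneg (v₁ v₂ : EuclideanSpace ℂ (Fin n)) : 0 ≤ normalForm v₁ v₂ := by
  refine div_nonneg (sub_nonneg.2 ?_) (by positivity)
  rw [← mul_pow]
  exact pow_le_pow_left₀ (norm_nonneg _) (norm_inner_le_norm _ _) 2

/-- Splitting `|v₂|²` along and across the complex line of `v₁` leaves, with `b = ⟨v₁, v₂⟩`, the
combination `-3 (Re b)² + (3/2) |b|² = -(3/2) Re(b²)`. -/
theorem curveSchwarzian_eq {v₁ : EuclideanSpace ℂ (Fin n)} (v₂ v₃ : EuclideanSpace ℂ (Fin n))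
    (hv : v₁ ≠ 0) :
    curveSchwarzian v₁ v₂ v₃ = (schwarzianForm v₁ v₂ v₃).re + 3 / 2 * normalForm v₁ v₂ := by
  have hl : ‖v₁‖ ≠ 0 := norm_ne_zero_iff.2 hv
  have h : ∀ b c : ℂ, (c / ((‖v₁‖ ^ 2 : ℝ) : ℂ) - 3 / 2 * (b / ((‖v₁‖ ^ 2 : ℝ) : ℂ)) ^ 2).re
      = c.re / ‖v₁‖ ^ 2 - 3 / 2 * ((b.re / ‖v₁‖ ^ 2) ^ 2 - (b.im / ‖v₁‖ ^ 2) ^ 2) := by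
    intro b c
    have e1 : (3 / 2 : ℂ) = ((3 / 2 : ℝ) : ℂ) := by norm_num
    rw [sub_re, div_ofReal_re, e1, re_ofReal_mul, sq (b / _), mul_re, div_ofReal_re, div_ofReal_im]
    ring
  rw [curveSchwarzian, schwarzianForm, h, normalForm, ← normSq_eq_norm_sq (inner ℂ v₁ v₂),
    normSq_apply, real_inner_eq_re_inner_euclidean, real_inner_eq_re_inner_euclidean]
  field_simp
  ring

variable (v₁ v₂ v₃ : EuclideanSpace ℂ (Fin n)) {t₁ t₂ t₃ : ℂ}

theorem ofReal_norm_sq_eq_inner : ((‖v₁‖ ^ 2 : ℝ) : ℂ) = inner ℂ v₁ v₁ := by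
  rw [inner_self_eq_norm_sq_to_K]
  simp

/-- The hypothesis `hS` says that the change of parameter has vanishing Schwarzian, which removes
the additive term of the chain rule. -/
theorem schwarzianForm_chain (hv : v₁ ≠ 0) (ht : t₁ ≠ 0) (hS : t₃ * t₁ = 3 / 2 * t₂ ^ 2) :
    schwarzianForm (t₁ • v₁) (t₁ ^ 2 • v₂ + t₂ • v₁)
      (t₁ ^ 3 • v₃ + (3 * t₁ * t₂) • v₂ + t₃ • v₁) = t₁ ^ 2 * schwarzianForm v₁ v₂ v₃ := by
  have hl : (inner ℂ v₁ v₁ : ℂ) ≠ 0 := inner_self_ne_zero.2 hv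
  have ht' : (starRingEnd ℂ) t₁ ≠ 0 := (map_ne_zero _).2 ht
  simp only [schwarzianForm, ofReal_norm_sq_eq_inner, inner_smul_left, inner_smul_right,
    inner_add_right]
  field_simp
  linear_combination (2 * (inner ℂ v₁ v₁ : ℂ) ^ 2) * hS

/-- The added term `t₂ • v₁` lies in the complex line of `v₁` and has no normal component. -/
theorem normalForm_chain (ht : t₁ ≠ 0) :
    normalForm (t₁ • v₁) (t₁ ^ 2 • v₂ + t₂ • v₁) = ‖t₁‖ ^ 2 * normalForm v₁ v₂ := by
  rcases eq_or_ne v₁ 0 with rfl | hv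
  · simp [normalForm]
  have hl : (inner ℂ v₁ v₁ : ℂ) ≠ 0 := inner_self_ne_zero.2 hv
  have ht' : (starRingEnd ℂ) t₁ ≠ 0 := (map_ne_zero _).2 ht
  have hn : ∀ z : ℂ, (‖z‖ : ℂ) ^ 2 = z * (starRingEnd ℂ) z := fun z => (mul_conj' z).symm
  have hv' : ∀ v : EuclideanSpace ℂ (Fin n), (‖v‖ : ℂ) ^ 2 = inner ℂ v v := fun v => by
    rw [← ofReal_norm_sq_eq_inner, ofReal_pow]
  rw [← ofReal_inj]
  push_cast [normalForm]
  simp only [hn, hv', inner_smul_left, inner_smul_right,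
    inner_add_right, inner_add_left, map_mul, map_add, map_pow, inner_conj_symm, conj_conj]
  field_simp
  ring

end Chain

/-- To be used with `r = |T(t)|` and `s = |T'(t)|` for a disk automorphism `T`. -/
theorem nehari_weight_le {p : ℝ → ℝ} (hp : IsNehari p) {t r s : ℝ} (ht : t ∈ Ioo (-1 : ℝ) 1)
    (hr : |t| ≤ r) (hr1 : r < 1) (hs : s * (1 - t ^ 2) = 1 - r ^ 2) : s ^ 2 * p r ≤ p t := by
  have ht1 : |t| < 1 := abs_lt.2 ht
  have h1 := hp.antitoneOn ⟨abs_nonneg t, ht1⟩ ⟨(abs_nonneg t).trans hr, hr1⟩ hr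
  simp only [sq_abs] at h1
  have h2 : p |t| = p t := by
    rcases abs_choice t with h | h
    · rw [h]
    · rw [h, hp.even t ht]
  have h3 : 0 < 1 - t ^ 2 := by
    have := (sq_lt_one_iff_abs_lt_one t).2 ht1
    linarith
  rw [h2, ← hs, mul_pow, mul_right_comm, mul_comm] at h1
  exact le_of_mul_le_mul_left h1 (by positivity)

/-! ### Hyperbolic geodesics parametrized by disk automorphisms -/

section Moebius

/-- The automorphism `z ↦ ω (z + i ρ) / (1 - i ρ z)` of the unit disk (`|ω| = 1`, `0 ≤ ρ < 1`). -/
noncomputable def moebius (ω : ℂ) (ρ : ℝ) (z : ℂ) : ℂ := ω * ((z + I * ρ) / (1 - I * ρ * z))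

/-- The derivative of `moebius`. -/
noncomputable def moebiusDeriv (ω : ℂ) (ρ : ℝ) (z : ℂ) : ℂ :=
  ω * (1 - (ρ : ℂ) ^ 2) * ((1 - I * ρ * z) ^ 2)⁻¹

theorem one_sub_I_mul_ne_zero (ρ t : ℝ) : 1 - I * ρ * t ≠ 0 := fun h => by
  have := congrArg re h
  simp at this

variable {ω : ℂ} {ρ : ℝ}

theorem hasDerivAt_one_sub_I_mul (t : ℝ) :
    HasDerivAt (fun s : ℝ => 1 - I * ρ * (s : ℂ)) (-(I * ρ)) t := by
  simpa using! ((hasDerivAt_id t).ofReal_comp.const_mul (I * (ρ : ℂ))).const_sub 1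

theorem hasDerivAt_moebius (t : ℝ) :
    HasDerivAt (fun s : ℝ => moebius ω ρ s) (moebiusDeriv ω ρ t) t := by
  have h0 := one_sub_I_mul_ne_zero ρ t
  refine ((((hasDerivAt_id t).ofReal_comp.add_const (I * (ρ : ℂ))).div
    (hasDerivAt_one_sub_I_mul t) h0).const_mul ω).congr_deriv ?_
  simp only [moebiusDeriv, id]
  push_cast
  field_simp
  linear_combination (ω * (ρ : ℂ) ^ 2) * I_sq

theorem hasDerivAt_moebiusDeriv (t : ℝ) :
    HasDerivAt (fun s : ℝ => moebiusDeriv ω ρ s)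
      (moebiusDeriv ω ρ t * (2 * (I * ρ / (1 - I * ρ * t)))) t := by
  have h0 := one_sub_I_mul_ne_zero ρ t
  refine ((((hasDerivAt_one_sub_I_mul t).pow 2).inv (pow_ne_zero 2 h0)).const_mul
    (ω * (1 - (ρ : ℂ) ^ 2))).congr_deriv ?_
  simp only [moebiusDeriv, Pi.pow_apply]
  push_cast
  field_simp

theorem hasDerivAt_moebiusDeriv_two (t : ℝ) :
    HasDerivAt (fun s : ℝ => moebiusDeriv ω ρ s * (2 * (I * ρ / (1 - I * ρ * s))))
      (moebiusDeriv ω ρ t * (6 * (I * ρ / (1 - I * ρ * t)) ^ 2)) t := by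
  have h0 := one_sub_I_mul_ne_zero ρ t
  refine ((hasDerivAt_moebiusDeriv t).mul ((((hasDerivAt_one_sub_I_mul t).inv h0).const_mul
    (I * (ρ : ℂ))).const_mul 2)).congr_deriv ?_
  simp only [moebiusDeriv, Pi.inv_apply]
  field_simp
  ring

theorem normSq_one_sub_I_mul (ρ t : ℝ) : ‖1 - I * ρ * t‖ ^ 2 = 1 + ρ ^ 2 * t ^ 2 := by
  rw [← normSq_eq_norm_sq, normSq_apply]
  simp
  ring

theorem norm_moebius_sq (hω : ‖ω‖ = 1) (t : ℝ) :
    ‖moebius ω ρ t‖ ^ 2 = (t ^ 2 + ρ ^ 2) / (1 + ρ ^ 2 * t ^ 2) := by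
  rw [moebius, norm_mul, hω, one_mul, norm_div, div_pow, normSq_one_sub_I_mul,
    ← normSq_eq_norm_sq, normSq_apply]
  simp
  ring

theorem norm_moebiusDeriv (hω : ‖ω‖ = 1) (hρ : ρ ^ 2 < 1) (t : ℝ) :
    ‖moebiusDeriv ω ρ t‖ = (1 - ρ ^ 2) / (1 + ρ ^ 2 * t ^ 2) := by
  have : ‖(1 - (ρ : ℂ) ^ 2)‖ = 1 - ρ ^ 2 := by
    rw [← ofReal_pow, ← ofReal_one, ← ofReal_sub, norm_real, Real.norm_of_nonneg (by linarith)]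
  rw [moebiusDeriv, norm_mul, norm_mul, hω, one_mul, norm_inv, norm_pow, normSq_one_sub_I_mul,
    this, div_eq_mul_inv]

theorem norm_moebius_lt_one (hω : ‖ω‖ = 1) (hρ : ρ ^ 2 < 1) {t : ℝ} (ht : t ^ 2 < 1) :
    ‖moebius ω ρ t‖ < 1 := by
  have h : ‖moebius ω ρ t‖ ^ 2 < 1 := by
    rw [norm_moebius_sq hω, div_lt_one (by positivity)]
    nlinarith
  exact (sq_lt_one_iff₀ (norm_nonneg _)).1 h

/-- The parameter `0` goes to the point `i ω ρ` of the geodesic closest to the origin. The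
inequality itself amounts to `ρ² (1 - t⁴) ≥ 0`. -/
theorem abs_le_norm_moebius (hω : ‖ω‖ = 1) {t : ℝ} (ht : t ^ 2 < 1) :
    |t| ≤ ‖moebius ω ρ t‖ := by
  refine abs_le_of_sq_le_sq ?_ (norm_nonneg _)
  rw [norm_moebius_sq hω, le_div_iff₀ (by positivity)]
  nlinarith [mul_nonneg (sq_nonneg ρ) (sub_nonneg.2 (pow_le_one₀ (sq_nonneg t) ht.le (n := 2)))]

/-- Disk automorphisms are isometries of the hyperbolic metric. -/
theorem norm_moebiusDeriv_mul (hω : ‖ω‖ = 1) (hρ : ρ ^ 2 < 1) (t : ℝ) :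
    ‖moebiusDeriv ω ρ t‖ * (1 - t ^ 2) = 1 - ‖moebius ω ρ t‖ ^ 2 := by
  rw [norm_moebiusDeriv hω hρ, norm_moebius_sq hω]
  have : 1 + ρ ^ 2 * t ^ 2 ≠ 0 := by positivity
  field_simp
  ring

/-- Two complex numbers are on a common line `Im (ω̄ w) = m`, with `m ≥ 0` and `|ω| = 1`. -/
theorem exists_unit_im_eq (p₁ p₂ : ℂ) : ∃ ω : ℂ, ‖ω‖ = 1 ∧ 0 ≤ ((starRingEnd ℂ) ω * p₁).im ∧
    ((starRingEnd ℂ) ω * p₂).im = ((starRingEnd ℂ) ω * p₁).im := by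
  have h : ∃ ω : ℂ, ‖ω‖ = 1 ∧ ((starRingEnd ℂ) ω * p₂).im = ((starRingEnd ℂ) ω * p₁).im := by
    rcases eq_or_ne p₁ p₂ with rfl | hne
    · exact ⟨1, by simp, rfl⟩
    · have hd : ‖p₂ - p₁‖ ≠ 0 := norm_ne_zero_iff.2 (sub_ne_zero.2 hne.symm)
      refine ⟨(p₂ - p₁) / ‖p₂ - p₁‖, by simp [hd], ?_⟩
      rw [← sub_eq_zero, ← sub_im, ← mul_sub, map_div₀, conj_ofReal, div_mul_eq_mul_div,
        mul_comm, mul_conj, ← ofReal_div, ofReal_im]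
  obtain ⟨ω, h1, h2⟩ := h
  rcases le_total 0 ((starRingEnd ℂ) ω * p₁).im with h | h
  · exact ⟨ω, h1, h, h2⟩
  · refine ⟨-ω, by simpa, ?_, ?_⟩
    · rw [map_neg, neg_mul, neg_im]
      linarith
    · rw [map_neg, neg_mul, neg_mul, neg_im, neg_im, h2]

theorem exists_mul_one_add_sq_eq {m : ℝ} (h0 : 0 ≤ m) (h1 : m < 1) :
    ∃ ρ : ℝ, ρ ^ 2 < 1 ∧ m * (1 + ρ ^ 2) = 2 * ρ := by
  have hs : √(1 - m ^ 2) ^ 2 = 1 - m ^ 2 := Real.sq_sqrt (by nlinarith)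
  have hs0 : 0 ≤ √(1 - m ^ 2) := Real.sqrt_nonneg _
  -- The smaller root of `m ρ² - 2 ρ + m = 0`, written so that `m = 0` is covered.
  refine ⟨m / (1 + √(1 - m ^ 2)), ?_, ?_⟩
  · rw [div_pow, div_lt_one (by positivity)]
    nlinarith
  · have : 1 + √(1 - m ^ 2) ≠ 0 := by positivity
    field_simp
    nlinarith

theorem exists_moebius_eq (hω : ‖ω‖ = 1) (hρ : ρ ^ 2 < 1) {z : ℂ} (hz : ‖z‖ < 1)
    (h : ((starRingEnd ℂ) ω * z).im * (1 + ρ ^ 2) = ρ * (1 + ‖z‖ ^ 2)) :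
    ∃ t : ℝ, t ^ 2 < 1 ∧ moebius ω ρ t = z := by
  have hωω : ω * (starRingEnd ℂ) ω = 1 := by rw [mul_conj, normSq_eq_norm_sq, hω]; simp
  set v : ℂ := (starRingEnd ℂ) ω * z with hv
  have hvz : ‖v‖ = ‖z‖ := by rw [hv, norm_mul, RCLike.norm_conj, hω, one_mul]
  have hωv : ω * v = z := by rw [hv, ← mul_assoc, hωω, one_mul]
  have hρ1 : ‖I * (ρ : ℂ)‖ < 1 := by
    rw [norm_mul, norm_I, one_mul, norm_real, Real.norm_eq_abs]
    exact (sq_lt_one_iff_abs_lt_one ρ).1 hρ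
  have hden : 1 + I * ρ * v ≠ 0 := by
    intro h0
    have h1 : ‖I * ρ * v‖ = 1 := by
      rw [eq_neg_of_add_eq_zero_right h0, norm_neg, norm_one]
    rw [norm_mul, hvz] at h1
    nlinarith [norm_nonneg z, norm_nonneg (I * (ρ : ℂ))]
  rw [← hvz] at h hz
  have hvsq : ‖v‖ ^ 2 = v.re * v.re + v.im * v.im := by
    rw [← normSq_eq_norm_sq, normSq_apply]
  -- The preimage of `z`; the hypothesis `h`, the equation of the geodesic, says that it is real.
  set τ : ℂ := (v - I * ρ) / (1 + I * ρ * v) with hτ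
  have him : τ.im = 0 := by
    rw [hτ, div_im, ← sub_div, div_eq_zero_iff]
    left
    simp
    rw [hvsq] at h
    linear_combination h
  have hτt : τ = (τ.re : ℂ) := by
    apply Complex.ext <;> simp [him]
  have heq : moebius ω ρ (τ.re : ℂ) = z := by
    have h0 := one_sub_I_mul_ne_zero ρ τ.re
    rw [moebius, ← hωv]
    congr 1
    have hτd : τ * (1 + I * ρ * v) = v - I * ρ := div_mul_cancel₀ _ hden
    rw [div_eq_iff h0, ← hτt]
    linear_combination hτd
  refine ⟨τ.re, ?_, heq⟩
  have h2 := norm_moebius_sq (ρ := ρ) hω τ.re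
  rw [heq, ← hvz, eq_div_iff (by positivity)] at h2
  have h3 : ‖v‖ ^ 2 < 1 := (sq_lt_one_iff₀ (norm_nonneg _)).2 hz
  nlinarith [sq_nonneg (ρ * τ.re)]

/-- Any two points of the unit disk are images of points of `(-1, 1)` under a map `moebius`. -/
theorem exists_moebius_eq_eq {z₁ z₂ : ℂ} (h₁ : ‖z₁‖ < 1) (h₂ : ‖z₂‖ < 1) :
    ∃ (ω : ℂ) (ρ t₁ t₂ : ℝ), ‖ω‖ = 1 ∧ ρ ^ 2 < 1 ∧ t₁ ^ 2 < 1 ∧ t₂ ^ 2 < 1 ∧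
      moebius ω ρ t₁ = z₁ ∧ moebius ω ρ t₂ = z₂ := by
  -- Up to a factor `2`, `z ↦ z / (1 + |z|²)` is the passage to the Klein model, where geodesics are
  -- straight chords: `ω` is a direction of a line through both image points.
  obtain ⟨ω, hω, hm, hm'⟩ := exists_unit_im_eq (z₁ / ((1 + ‖z₁‖ ^ 2 : ℝ) : ℂ))
    (z₂ / ((1 + ‖z₂‖ ^ 2 : ℝ) : ℂ))
  rw [← mul_div_assoc, ← mul_div_assoc, div_ofReal_im, div_ofReal_im] at hm'
  rw [← mul_div_assoc, div_ofReal_im] at hm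
  have hlt : 2 * (((starRingEnd ℂ) ω * z₁).im / (1 + ‖z₁‖ ^ 2)) < 1 := by
    have h : ((starRingEnd ℂ) ω * z₁).im ≤ ‖z₁‖ :=
      (im_le_norm _).trans (by rw [norm_mul, RCLike.norm_conj, hω, one_mul])
    rw [← mul_div_assoc, div_lt_one (by positivity)]
    nlinarith [sq_pos_of_pos (sub_pos.2 h₁)]
  obtain ⟨ρ, hρ, hρm⟩ := exists_mul_one_add_sq_eq (mul_nonneg zero_le_two hm) hlt
  obtain ⟨t₁, ht₁, he₁⟩ := exists_moebius_eq hω hρ h₁ (by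
    field_simp at hρm
    linear_combination hρm)
  rw [← hm'] at hρm
  obtain ⟨t₂, ht₂, he₂⟩ := exists_moebius_eq hω hρ h₂ (by
    field_simp at hρm
    linear_combination hρm)
  exact ⟨ω, ρ, t₁, t₂, hω, hρ, ht₁, ht₂, he₁, he₂⟩

end Moebius

/-! ### The criterion on the disk -/

section Disk

variable {n : ℕ} {φ : ℂ → EuclideanSpace ℂ (Fin n)} {z : ℂ}

theorem hasDerivAt_deriv_of_differentiableOn_ball {F : Type*} [NormedAddCommGroup F]
    [NormedSpace ℂ F] {f : ℂ → F} {z : ℂ} (hf : DifferentiableOn ℂ f (Metric.ball 0 1))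
    (hz : z ∈ Metric.ball (0 : ℂ) 1) : HasDerivAt f (deriv f z) z :=
  (hf.differentiableAt (Metric.isOpen_ball.mem_nhds hz)).hasDerivAt

theorem eventually_hasDerivAt_of_differentiableOn_ball {F : Type*} [NormedAddCommGroup F]
    [NormedSpace ℂ F] {f : ℂ → F} {z : ℂ} (hf : DifferentiableOn ℂ f (Metric.ball 0 1))
    (hz : z ∈ Metric.ball (0 : ℂ) 1) : ∀ᶠ w in 𝓝 z, HasDerivAt f (deriv f w) w :=
  mem_of_superset (Metric.isOpen_ball.mem_nhds hz) fun _ hw =>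
    hasDerivAt_deriv_of_differentiableOn_ball hf hw

theorem schwarzian_eq_schwarzianForm (hφ : DifferentiableOn ℂ φ (Metric.ball 0 1))
    (hz : z ∈ Metric.ball (0 : ℂ) 1) (hne : deriv φ z ≠ 0) :
    schwarzian φ z
      = schwarzianForm (deriv φ z) (deriv (deriv φ) z) (deriv (deriv (deriv φ)) z) :=
  have h₁ := hφ.deriv Metric.isOpen_ball
  have h₂ := h₁.deriv Metric.isOpen_ball
  schwarzian_eq (eventually_hasDerivAt_of_differentiableOn_ball hφ hz)
    (eventually_hasDerivAt_of_differentiableOn_ball h₁ hz)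
    (hasDerivAt_deriv_of_differentiableOn_ball h₂ hz) hne

theorem gaussianCurvature_eq_normalForm (hφ : DifferentiableOn ℂ φ (Metric.ball 0 1))
    (hz : z ∈ Metric.ball (0 : ℂ) 1) (hne : deriv φ z ≠ 0) :
    ‖deriv φ z‖ ^ 2 * gaussianCurvature φ z
      = -2 * normalForm (deriv φ z) (deriv (deriv φ) z) := by
  have h₁ := hφ.deriv Metric.isOpen_ball
  have h₂ := h₁.deriv Metric.isOpen_ball
  have hl : ‖deriv φ z‖ ≠ 0 := norm_ne_zero_iff.2 hne
  rw [gaussianCurvature_eq (eventually_hasDerivAt_of_differentiableOn_ball hφ hz)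
    (eventually_hasDerivAt_of_differentiableOn_ball h₁ hz)
    (hasDerivAt_deriv_of_differentiableOn_ball h₂ hz) hne, normalForm]
  field_simp

theorem injOn_of_norm_schwarzian_le {p : ℝ → ℝ} (hp : IsNehari p)
    (hφ : DifferentiableOn ℂ φ (Metric.ball 0 1))
    (hne : ∀ z ∈ Metric.ball (0 : ℂ) 1, deriv φ z ≠ 0)
    (hS : ∀ z ∈ Metric.ball (0 : ℂ) 1,
      ‖schwarzian φ z‖ + 3 / 4 * ‖deriv φ z‖ ^ 2 * |gaussianCurvature φ z| ≤ 2 * p ‖z‖) :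
    InjOn φ (Metric.ball 0 1) := by
  intro z₁ hz₁ z₂ hz₂ heq
  have h₁ := hφ.deriv Metric.isOpen_ball
  have h₂ := h₁.deriv Metric.isOpen_ball
  obtain ⟨ω, ρ, t₁, t₂, hω, hρ, ht₁, ht₂, rfl, rfl⟩ := exists_moebius_eq_eq
    (mem_ball_zero_iff.1 hz₁) (mem_ball_zero_iff.1 hz₂)
  have hsq : ∀ t ∈ Ioo (-1 : ℝ) 1, t ^ 2 < 1 := fun t ht =>
    (sq_lt_one_iff_abs_lt_one t).2 (abs_lt.2 ht)
  have hmem : ∀ t ∈ Ioo (-1 : ℝ) 1, moebius ω ρ t ∈ Metric.ball (0 : ℂ) 1 := fun t ht =>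
    mem_ball_zero_iff.2 (norm_moebius_lt_one hω hρ (hsq t ht))
  have hω0 : ω ≠ 0 := norm_ne_zero_iff.1 (by rw [hω]; exact one_ne_zero)
  have hT0 : ∀ t : ℝ, moebiusDeriv ω ρ t ≠ 0 := fun t => by
    rw [← norm_ne_zero_iff, norm_moebiusDeriv hω hρ]
    exact (div_pos (by linarith) (by positivity)).ne'
  set T₁ : ℝ → ℂ := fun t => moebiusDeriv ω ρ t with hT₁
  set T₂ : ℝ → ℂ := fun t => moebiusDeriv ω ρ t * (2 * (I * ρ / (1 - I * ρ * t))) with hT₂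
  set T₃ : ℝ → ℂ := fun t => moebiusDeriv ω ρ t * (6 * (I * ρ / (1 - I * ρ * t)) ^ 2) with hT₃
  have hcomp : ∀ f : ℂ → EuclideanSpace ℂ (Fin n), DifferentiableOn ℂ f (Metric.ball 0 1) →
      ∀ t ∈ Ioo (-1 : ℝ) 1, HasDerivAt (fun t : ℝ => f (moebius ω ρ t))
        (T₁ t • deriv f (moebius ω ρ t)) t := fun f hf t ht =>
    (hasDerivAt_deriv_of_differentiableOn_ball hf (hmem t ht)).scomp t (hasDerivAt_moebius t)
  have hinj := injOn_of_curveSchwarzian_le hp (γ := fun t => φ (moebius ω ρ t))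
    (γ₁ := fun t => T₁ t • deriv φ (moebius ω ρ t))
    (γ₂ := fun t => T₁ t ^ 2 • deriv (deriv φ) (moebius ω ρ t) + T₂ t • deriv φ (moebius ω ρ t))
    (γ₃ := fun t => T₁ t ^ 3 • deriv (deriv (deriv φ)) (moebius ω ρ t)
      + (3 * T₁ t * T₂ t) • deriv (deriv φ) (moebius ω ρ t) + T₃ t • deriv φ (moebius ω ρ t))
    (hcomp φ hφ) (fun t ht => ?_) (fun t ht => ?_)
    (fun t ht => smul_ne_zero (hT0 t) (hne _ (hmem t ht))) (fun t ht => ?_)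
  · rw [hinj (abs_lt.1 ((sq_lt_one_iff_abs_lt_one t₁).1 ht₁))
      (abs_lt.1 ((sq_lt_one_iff_abs_lt_one t₂).1 ht₂)) heq]
  · refine ((hasDerivAt_moebiusDeriv t).smul (hcomp _ h₁ t ht)).congr_deriv ?_
    rw [smul_smul, ← sq]
  · refine ((((hasDerivAt_moebiusDeriv t).pow 2).smul (hcomp _ h₂ t ht)).add
      ((hasDerivAt_moebiusDeriv_two t).smul (hcomp _ h₁ t ht))).congr_deriv ?_
    simp only [Pi.pow_apply, hT₁, hT₂, hT₃]
    module
  · have hz := hmem t ht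
    have hv := hne _ hz
    have hrel : T₃ t * T₁ t = 3 / 2 * T₂ t ^ 2 := by
      simp only [hT₁, hT₂, hT₃]
      ring
    rw [curveSchwarzian_eq _ _ (smul_ne_zero (hT0 t) hv), schwarzianForm_chain _ _ _ hv (hT0 t) hrel,
      normalForm_chain _ _ (hT0 t), ← schwarzian_eq_schwarzianForm hφ hz hv]
    -- The curvature is non-positive, with `|φ'|² |K|` equal to twice the normal part; thus `3/4`
    -- becomes the `3/2` of `curveSchwarzian_eq`.
    have hK : 3 / 4 * ‖deriv φ (moebius ω ρ t)‖ ^ 2 * |gaussianCurvature φ (moebius ω ρ t)|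
        = 3 / 2 * normalForm (deriv φ (moebius ω ρ t)) (deriv (deriv φ) (moebius ω ρ t)) := by
      rw [mul_assoc, ← abs_of_nonneg (sq_nonneg ‖deriv φ (moebius ω ρ t)‖), ← abs_mul,
        gaussianCurvature_eq_normalForm hφ hz hv, abs_mul, abs_of_nonneg (normalForm_nonneg _ _)]
      norm_num
      ring
    have h3 := hS _ hz
    rw [hK] at h3
    have h4 := nehari_weight_le hp ht (abs_le_norm_moebius (ρ := ρ) hω (hsq t ht))
      (mem_ball_zero_iff.1 hz) (norm_moebiusDeriv_mul hω hρ t)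
    have h5 : (T₁ t ^ 2 * schwarzian φ (moebius ω ρ t)).re
        ≤ ‖T₁ t‖ ^ 2 * ‖schwarzian φ (moebius ω ρ t)‖ :=
      (re_le_norm _).trans (by rw [norm_mul, norm_pow])
    have h6 := mul_le_mul_of_nonneg_left h3 (sq_nonneg ‖T₁ t‖)
    linarith

end Disk

/-! ### The case `n = 1` -/

section OneDimensional

variable {f : ℂ → ℂ} {z : ℂ}

theorem hasDerivAt_vec_one {f' : ℂ} (h : HasDerivAt f f' z) :
    HasDerivAt (fun w => (!₂[f w] : EuclideanSpace ℂ (Fin 1))) (!₂[f']) z := by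
  have e : ∀ c : ℂ, (!₂[c] : EuclideanSpace ℂ (Fin 1)) = c • !₂[(1 : ℂ)] := fun c => by
    ext i
    fin_cases i
    simp
  simp only [e (f _), e f']
  exact h.smul_const _

theorem schwarzianForm_vec_one {a : ℂ} (ha : a ≠ 0) (b c : ℂ) :
    schwarzianForm (!₂[a] : EuclideanSpace ℂ (Fin 1)) (!₂[b]) (!₂[c])
      = c / a - 3 / 2 * (b / a) ^ 2 := by
  have ha' : (starRingEnd ℂ) a ≠ 0 := (map_ne_zero _).2 ha
  simp only [schwarzianForm, ofReal_norm_sq_eq_inner, PiLp.inner_apply]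
  simp [← mul_conj']
  field_simp

/-- In `ℂ¹` there is no normal direction: Cauchy–Schwarz is an equality. -/
theorem normalForm_vec_one (a b : ℂ) :
    normalForm (!₂[a] : EuclideanSpace ℂ (Fin 1)) (!₂[b]) = 0 := by
  simp only [normalForm, EuclideanSpace.norm_sq_eq, PiLp.inner_apply]
  simp
  left
  ring

theorem classicalSchwarzian_eq (hf : DifferentiableOn ℂ f (Metric.ball 0 1))
    (hz : z ∈ Metric.ball (0 : ℂ) 1) (hne : deriv f z ≠ 0) :
    classicalSchwarzian f z
      = deriv (deriv (deriv f)) z / deriv f z - 3 / 2 * (deriv (deriv f) z / deriv f z) ^ 2 := by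
  have h₁ := hf.deriv Metric.isOpen_ball
  have h₂ := h₁.deriv Metric.isOpen_ball
  rw [classicalSchwarzian, ((hasDerivAt_deriv_of_differentiableOn_ball h₂ hz).fun_div
    (hasDerivAt_deriv_of_differentiableOn_ball h₁ hz) hne).deriv]
  field_simp
  ring

theorem schwarzian_vec_one (hf : DifferentiableOn ℂ f (Metric.ball 0 1))
    (hz : z ∈ Metric.ball (0 : ℂ) 1) (hne : deriv f z ≠ 0) :
    schwarzian (fun w => !₂[f w]) z = classicalSchwarzian f z := by
  have h₁ := hf.deriv Metric.isOpen_ball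
  have h₂ := h₁.deriv Metric.isOpen_ball
  rw [classicalSchwarzian_eq hf hz hne, ← schwarzianForm_vec_one hne]
  exact schwarzian_eq (φ₁ := fun w => !₂[deriv f w]) (φ₂ := fun w => !₂[deriv (deriv f) w])
    (φ₃ := fun w => !₂[deriv (deriv (deriv f)) w])
    ((eventually_hasDerivAt_of_differentiableOn_ball hf hz).mono fun _ h => hasDerivAt_vec_one h)
    ((eventually_hasDerivAt_of_differentiableOn_ball h₁ hz).mono fun _ h => hasDerivAt_vec_one h)
    (hasDerivAt_vec_one (hasDerivAt_deriv_of_differentiableOn_ball h₂ hz)) (by simpa using! hne)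

theorem gaussianCurvature_vec_one (hf : DifferentiableOn ℂ f (Metric.ball 0 1))
    (hz : z ∈ Metric.ball (0 : ℂ) 1) (hne : deriv f z ≠ 0) :
    gaussianCurvature (fun w => !₂[f w]) z = 0 := by
  have hv : ∀ w ∈ Metric.ball (0 : ℂ) 1, HasDerivAt (fun w => !₂[f w]) (!₂[deriv f w]) w :=
    fun w hw => hasDerivAt_vec_one (hasDerivAt_deriv_of_differentiableOn_ball hf hw)
  have hvd : deriv (fun w => (!₂[f w] : EuclideanSpace ℂ (Fin 1))) =ᶠ[𝓝 z]
      fun w => !₂[deriv f w] :=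
    mem_of_superset (Metric.isOpen_ball.mem_nhds hz) fun w hw => (hv w hw).deriv
  have hne' : (!₂[deriv f z] : EuclideanSpace ℂ (Fin 1)) ≠ 0 := by simpa using! hne
  have h := gaussianCurvature_eq_normalForm (φ := fun w => !₂[f w])
    (fun w hw => (hv w hw).differentiableAt.differentiableWithinAt) hz
    (by rwa [hvd.self_of_nhds])
  rw [hvd.deriv_eq, hvd.self_of_nhds, (hasDerivAt_vec_one
    (hasDerivAt_deriv_of_differentiableOn_ball (hf.deriv Metric.isOpen_ball) hz)).deriv,
    normalForm_vec_one, mul_zero] at h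
  exact (mul_eq_zero.1 h).resolve_left (pow_ne_zero 2 (norm_ne_zero_iff.2 hne'))

end OneDimensional

end HolCurve

theorem theorem1 (p : ℝ → ℝ) (hp : HolCurve.IsNehari p) :
    -- the criterion for holomorphic curves in `ℂⁿ`
    (∀ (n : ℕ) (φ : ℂ → EuclideanSpace ℂ (Fin n)),
      DifferentiableOn ℂ φ (Metric.ball 0 1) →
      (∀ z ∈ Metric.ball (0 : ℂ) 1, deriv φ z ≠ 0) →
      (∀ z ∈ Metric.ball (0 : ℂ) 1,
        ‖HolCurve.schwarzian φ z‖ + 3 / 4 * ‖deriv φ z‖ ^ 2 * |HolCurve.gaussianCurvature φ z|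
          ≤ 2 * p ‖z‖) →
      Set.InjOn φ (Metric.ball 0 1)) ∧
    -- the case `n = 1`: the Schwarzian is the classical one, the curvature vanishes, and the
    -- criterion is that of Nehari
    (∀ f : ℂ → ℂ,
      DifferentiableOn ℂ f (Metric.ball 0 1) →
      (∀ z ∈ Metric.ball (0 : ℂ) 1, deriv f z ≠ 0) →
      (∀ z ∈ Metric.ball (0 : ℂ) 1,
        HolCurve.schwarzian (fun w => !₂[f w]) z = HolCurve.classicalSchwarzian f z ∧
        HolCurve.gaussianCurvature (fun w => !₂[f w]) z = 0) ∧
      ((∀ z ∈ Metric.ball (0 : ℂ) 1, ‖HolCurve.classicalSchwarzian f z‖ ≤ 2 * p ‖z‖) →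
        Set.InjOn f (Metric.ball 0 1))) := by
  refine ⟨fun n φ hφ hne hS => HolCurve.injOn_of_norm_schwarzian_le hp hφ hne hS,
    fun f hf hne => ?_⟩
  have h1 : ∀ z ∈ Metric.ball (0 : ℂ) 1,
      HolCurve.schwarzian (fun w => !₂[f w]) z = HolCurve.classicalSchwarzian f z ∧
      HolCurve.gaussianCurvature (fun w => !₂[f w]) z = 0 := fun z hz =>
    ⟨HolCurve.schwarzian_vec_one hf hz (hne z hz),
      HolCurve.gaussianCurvature_vec_one hf hz (hne z hz)⟩
  have hd : ∀ z ∈ Metric.ball (0 : ℂ) 1, HasDerivAt (fun w => !₂[f w]) (!₂[deriv f z]) z :=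
    fun z hz => HolCurve.hasDerivAt_vec_one
      (HolCurve.hasDerivAt_deriv_of_differentiableOn_ball hf hz)
  refine ⟨h1, fun hS => ?_⟩
  have hinj := HolCurve.injOn_of_norm_schwarzian_le hp (φ := fun w => !₂[f w])
    (fun z hz => (hd z hz).differentiableAt.differentiableWithinAt)
    (fun z hz => by
      rw [(hd z hz).deriv]
      simpa using! hne z hz)
    (fun z hz => by
      rw [(h1 z hz).1, (h1 z hz).2, abs_zero, mul_zero, add_zero]
      exact hS z hz)
  exact fun z hz w hw h => hinj hz hw (by simp only [h])
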